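/- Conventions. For $\psi:\mathbb{R}_{\ge 0}\to\mathbb{R}_{\ge 0}$ with $\psi(q)\to 0$, an irrational real number $\xi$ is called $\psi$-badly approximable if $|\xi-p/q|<\psi(q)$ has only finitely many solutions $p\in\mathbb{Z}$, $q\in\mathbb{N}$, $q\ge 1$. A Laurent series $f(z)\in\mathbb{Q}((z^{-1}))$ is called badly approximable if its continued fraction $f(z)=[a_0(z),a_1(z),a_2(z),\dots]$, with $a_i\in\mathbb{Q}[z]$, is infinite (that is, $f$ is not a rational function) and the degrees of all its partial quotients $a_i(z)$ are bounded by a constant. **Theorem.** Let $d\ge 2$ be an integer, let $P\in\mathbb{Z}[z]$ be a polynomial with $P(0)=1$ and $\deg P<d$, and let $$f(z)=\prod_{t=0}^{\infty}P\bigl(z^{-d^t}\bigr).$$ Assume that $f(z)$, as a Laurent series in $z^{-1}$, is badly approximable. Then there exists a constant $K>0$ such that for every integer $b$ with $|b|\ge 2$, either $f(b)=0$ or $f(b)$ is irrational and $q^{-2}\exp\bigl(-K\sqrt{\log q\,\log\log q}\bigr)$-badly approximable. In particular, this covers the Thue–Morse constant: let $t_0=0$, $t_{2n}=t_n$, $t_{2n+1}=1-t_n$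 for $n\ge 0$. Then there exists a constant $K>0$ such that $\sum_{k\ge 0}t_k2^{-k-1}$ is irrational and $q^{-2}\exp\bigl(-K\sqrt{\log q\,\log\log q}\bigr)$-badly approximable. -/

import Mathlib

open Polynomial

namespace MahlerMeasure

/-! ### Approximation of real numbers by rationals -/

/-- `ξ` is `ψ`-badly approximable: `ξ` is irrational and `|ξ - p / q| < ψ q` has only finitely many
solutions in integers `p` and `q ≥ 1`.  (For irrational `ξ` and `ψ → 0` a single rational number
is represented by only finitely many solutions, so counting pairs or fractions is the same.) -/
def IsPsiBadlyApproximable (ψ : ℝ → ℝ) (ξ : ℝ) : Prop :=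
  Irrational ξ ∧
    {x : ℤ × ℕ | 0 < x.2 ∧ |ξ - (x.1 : ℝ) / (x.2 : ℝ)| < ψ (x.2 : ℝ)}.Finite

/-- The function `q ↦ q⁻² exp (-K √(log q · log log q))`. -/
noncomputable def psi (K : ℝ) (q : ℝ) : ℝ :=
  (q ^ 2)⁻¹ * Real.exp (-K * Real.sqrt (Real.log q * Real.log (Real.log q)))

/-! ### Continued fractions of Laurent series in `z⁻¹`

The field `ℚ((z⁻¹))` is `LaurentSeries ℚ`, whose variable plays the role of `z⁻¹`: the
coefficient of `z ^ i` in `x` is `x.coeff (-i)`. -/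

/-- The embedding `ℚ[z] → ℚ((z⁻¹))`. -/
noncomputable def ofPoly : ℚ[X] →ₐ[ℚ] LaurentSeries ℚ :=
  Polynomial.aeval (HahnSeries.single (-1 : ℤ) (1 : ℚ))

/-- The polynomial part of a Laurent series in `z⁻¹`: the sum of its terms `c * z ^ i`, `i ≥ 0`
(there are none with `i > -x.order`). -/
noncomputable def polyPart (x : LaurentSeries ℚ) : ℚ[X] :=
  ∑ i ∈ Finset.range ((-x.order).toNat + 1), Polynomial.monomial i (x.coeff (-(i : ℤ)))

/-- The complete quotients of `x`: `x₀ = x` and `xₙ₊₁ = 1 / (xₙ - [xₙ])`. -/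
noncomputable def completeQuotient (x : LaurentSeries ℚ) : ℕ → LaurentSeries ℚ
  | 0 => x
  | n + 1 => (completeQuotient x n - ofPoly (polyPart (completeQuotient x n)))⁻¹

/-- The partial quotients `aₙ(z)` in `x = [a₀(z), a₁(z), a₂(z), …]`. -/
noncomputable def partialQuotient (x : LaurentSeries ℚ) (n : ℕ) : ℚ[X] :=
  polyPart (completeQuotient x n)

/-- The continued fraction of `x` does not terminate (equivalently, `x` is not the expansion of a
rational function). -/
def HasInfiniteContFract (x : LaurentSeries ℚ) : Prop :=
  ∀ n, completeQuotient x n ≠ ofPoly (partialQuotient x n)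

/-- `x` is badly approximable: it has an infinite continued fraction, and the degrees of all its
partial quotients are bounded by a constant. -/
def IsBadlyApproximableSeries (x : LaurentSeries ℚ) : Prop :=
  HasInfiniteContFract x ∧ ∃ M : ℕ, ∀ n, (partialQuotient x n).natDegree ≤ M

/-! ### The infinite product `f(z) = ∏ P(z^{-d^t})` -/

open scoped PowerSeries.WithPiTopology in
/-- The product `∏ₜ P(w ^ (d ^ t))` as a formal power series in `w` (coefficientwise
convergence, `ℤ` being discrete). -/
noncomputable def productSeries (d : ℕ) (P : ℤ[X]) : PowerSeries ℤ :=
  ∏' t : ℕ, ((Polynomial.expand ℤ (d ^ t) P : ℤ[X]) : PowerSeries ℤ)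

/-- `f(z) = ∏ₜ P(z^{-d^t})` as an element of `ℚ((z⁻¹))`. -/
noncomputable def mahlerSeries (d : ℕ) (P : ℤ[X]) : LaurentSeries ℚ :=
  HahnSeries.ofPowerSeries ℤ ℚ (PowerSeries.map (Int.castRingHom ℚ) (productSeries d P))

/-- The value `f(b) = ∏ₜ P(b^{-d^t})` at an integer `b`. -/
noncomputable def mahlerValue (d : ℕ) (P : ℤ[X]) (b : ℤ) : ℝ :=
  ∏' t : ℕ, Polynomial.aeval (((b : ℝ) ^ (d ^ t))⁻¹) P

/-! ### The Thue–Morse constant -/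

/-- The Thue–Morse sequence: `t 0 = 0`, `t (2 n) = t n`, `t (2 n + 1) = 1 - t n`. -/
def thueMorse (n : ℕ) : ℕ :=
  if _h : n = 0 then 0
  else if n % 2 = 0 then thueMorse (n / 2) else 1 - thueMorse (n / 2)
termination_by n
decreasing_by all_goals omega

/-- The number with binary expansion `0.t₀t₁t₂…`, where `t` is the Thue–Morse sequence. -/
noncomputable def thueMorseConstant : ℝ :=
  ∑' k : ℕ, (thueMorse k : ℝ) / 2 ^ (k + 1)

/-! ### The products converge -/

open scoped PowerSeries.WithPiTopology in
/-- If `P(0) = 1`, the product of formal power series defining `f` converges. -/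
theorem multipliable_productSeries {d : ℕ} (hd : 2 ≤ d) {P : ℤ[X]} (hP : P.coeff 0 = 1) :
    Multipliable fun t : ℕ => ((Polynomial.expand ℤ (d ^ t) P : ℤ[X]) : PowerSeries ℤ) := by
  have key : (fun t : ℕ => ((Polynomial.expand ℤ (d ^ t) P : ℤ[X]) : PowerSeries ℤ)) =
      fun t : ℕ => 1 + (((Polynomial.expand ℤ (d ^ t) P : ℤ[X]) : PowerSeries ℤ) - 1) := by
    funext t; ring
  rw [key]
  apply PowerSeries.WithPiTopology.multipliable_one_add_of_tendsto_order_atTop_nhds_top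
  rw [ENat.tendsto_nhds_top_iff_natCast_lt]
  intro n
  filter_upwards [Filter.eventually_gt_atTop n] with t ht
  refine lt_of_lt_of_le (Nat.cast_lt.mpr (Nat.lt_succ_self n)) (PowerSeries.nat_le_order _ _ ?_)
  intro i hi
  have hlt : i < d ^ t := by
    have h1 : t < d ^ t := Nat.lt_pow_self (by omega)
    omega
  rcases Nat.eq_zero_or_pos i with rfl | hpos
  · simp [Polynomial.coeff_expand (show 0 < d ^ t by omega), hP]
  · have : ¬ d ^ t ∣ i := fun h => absurd (Nat.le_of_dvd hpos h) (by omega)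
    simp [Polynomial.coeff_expand (show 0 < d ^ t by omega), this, PowerSeries.coeff_one,
      hpos.ne']

/-- If `P(0) = 1`, the product defining `f(b)` converges for all integers `b` with `|b| ≥ 2`. -/
theorem multipliable_mahlerValue {d : ℕ} (hd : 2 ≤ d) {P : ℤ[X]} (hP : P.coeff 0 = 1) {b : ℤ}
    (hb : 2 ≤ |b|) :
    Multipliable fun t : ℕ => Polynomial.aeval (((b : ℝ) ^ (d ^ t))⁻¹) P := by
  obtain ⟨Q, hQ⟩ : ∃ Q : ℤ[X], P = 1 + X * Q := by
    refine ⟨P.divX, ?_⟩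
    have := P.X_mul_divX_add
    rw [hP] at this
    rw [map_one, add_comm] at this
    exact this.symm
  have key : (fun t : ℕ => Polynomial.aeval (((b : ℝ) ^ (d ^ t))⁻¹) P) =
      fun t : ℕ => 1 + ((b : ℝ) ^ (d ^ t))⁻¹ * Polynomial.aeval (((b : ℝ) ^ (d ^ t))⁻¹) Q := by
    funext t; simp [hQ]
  rw [key]
  apply Real.multipliable_one_add_of_summable
  have hb' : (2 : ℝ) ≤ |(b : ℝ)| := by exact_mod_cast hb
  have hx : ∀ t : ℕ, |((b : ℝ) ^ (d ^ t))⁻¹| ≤ (1 / 2) ^ t := by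
    intro t
    have h1 : t ≤ d ^ t := (Nat.lt_pow_self (by omega)).le
    rw [abs_inv, abs_pow, one_div, inv_pow]
    apply inv_anti₀ (by positivity)
    calc (2 : ℝ) ^ t ≤ 2 ^ (d ^ t) := pow_le_pow_right₀ (by norm_num) h1
      _ ≤ _ := by gcongr
  obtain ⟨C, hC⟩ := (isCompact_Icc (a := (-1 : ℝ)) (b := 1)).exists_bound_of_continuousOn
    (f := fun x : ℝ => Polynomial.aeval x Q) (Polynomial.continuous_aeval Q).continuousOn
  refine Summable.of_norm_bounded (g := fun t : ℕ => (1 / 2 : ℝ) ^ t * C) ?_ ?_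
  · exact (summable_geometric_of_lt_one (by norm_num) (by norm_num)).mul_right C
  · intro t
    rw [norm_mul]
    have h2 := hx t
    have h3 : ((1 : ℝ) / 2) ^ t ≤ 1 := pow_le_one₀ (by norm_num) (by norm_num)
    gcongr
    · exact h2
    · exact hC _ (abs_le.mp (h2.trans h3))

end MahlerMeasure

/-- The function `x ↦ √(log x · log log x)`. -/
noncomputable def sqrtLogLogLog (x : ℝ) : ℝ :=
  Real.sqrt (Real.log x * Real.log (Real.log x))

/-- For all large integers `Q` and all integers `p`, the linear form `Q ξ - p` is at least
`Q⁻¹ exp (-K √(log Q · log log Q))` in absolute value. -/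
def HasLinearFormLowerBound (K ξ : ℝ) : Prop :=
  ∀ᶠ Q : ℕ in Filter.atTop, ∀ p : ℤ,
    Real.exp (-K * sqrtLogLogLog Q) ≤ Q * |Q * ξ - p|

lemma eventually_mul_sqrt_mul_log_le (c : ℝ) :
    ∀ᶠ x : ℝ in Filter.atTop, c * Real.sqrt (x * Real.log x) ≤ x := by
  have h1 : ∀ᶠ x : ℝ in Filter.atTop, ‖Real.log x‖ ≤ (1 / (c ^ 2 + 1)) * ‖x‖ :=
    Real.isLittleO_log_id_atTop.bound (by positivity)
  filter_upwards [h1, Filter.eventually_ge_atTop (1 : ℝ)] with x hx hx1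
  have hl : 0 ≤ Real.log x := Real.log_nonneg hx1
  rw [Real.norm_of_nonneg hl, Real.norm_of_nonneg (by linarith)] at hx
  have h2 : (c ^ 2 + 1) * Real.log x ≤ x := by
    have := mul_le_mul_of_nonneg_left hx (show 0 ≤ c ^ 2 + 1 by positivity)
    rwa [← mul_assoc, mul_one_div_cancel (by positivity), one_mul] at this
  refine le_of_abs_le ?_
  rw [abs_mul, abs_of_nonneg (Real.sqrt_nonneg _), ← Real.sqrt_sq_eq_abs,
    ← Real.sqrt_mul (sq_nonneg c)]
  refine Real.sqrt_le_iff.2 ⟨by linarith, ?_⟩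
  nlinarith

lemma tendsto_sqrtLogLogLog :
    Filter.Tendsto (fun Q : ℕ => sqrtLogLogLog Q) Filter.atTop Filter.atTop := by
  have h1 : Filter.Tendsto (fun Q : ℕ => Real.log (Q : ℝ)) Filter.atTop Filter.atTop :=
    Real.tendsto_log_atTop.comp tendsto_natCast_atTop_atTop
  exact Real.tendsto_sqrt_atTop.comp (h1.atTop_mul_atTop₀ (Real.tendsto_log_atTop.comp h1))

lemma finite_near_rationals {ψ : ℝ → ℝ} (ξ : ℝ) (Q₀ : ℕ)
    (h : ∀ Q : ℕ, Q₀ ≤ Q → ∀ p : ℤ, 0 < Q → ψ Q ≤ |ξ - p / Q|) :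
    {x : ℤ × ℕ | 0 < x.2 ∧ |ξ - (x.1 : ℝ) / (x.2 : ℝ)| < ψ (x.2 : ℝ)}.Finite := by
  refine Set.Finite.subset (s := ⋃ Q ∈ Finset.range Q₀,
    (fun p : ℤ => (p, Q)) '' Set.Icc ⌊(ξ - ψ Q) * Q⌋ ⌈(ξ + ψ Q) * Q⌉) ?_ ?_
  · exact Set.Finite.biUnion (Finset.finite_toSet _) fun Q _ => (Set.finite_Icc _ _).image _
  · rintro ⟨p, Q⟩ ⟨hQ, hlt⟩
    simp only at hQ hlt
    have hQ' : Q < Q₀ := by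
      by_contra hc
      exact absurd hlt (not_lt.2 (h Q (not_lt.1 hc) p hQ))
    simp only [Set.mem_iUnion, Finset.mem_range]
    refine ⟨Q, hQ', p, ?_, rfl⟩
    have hQr : (0 : ℝ) < Q := by exact_mod_cast hQ
    rw [abs_lt] at hlt
    constructor
    · have : (ξ - ψ Q) * Q ≤ p := by
        rw [← le_div_iff₀ hQr]; linarith
      exact_mod_cast (Int.floor_le _).trans this
    · have : (p : ℝ) ≤ (ξ + ψ Q) * Q := by
        rw [← div_le_iff₀ hQr]; linarith
      exact_mod_cast this.trans (Int.le_ceil _)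

lemma HasLinearFormLowerBound.isPsiBadlyApproximable {K ξ : ℝ}
    (h : HasLinearFormLowerBound K ξ) :
    MahlerMeasure.IsPsiBadlyApproximable (MahlerMeasure.psi K) ξ := by
  obtain ⟨Q₀, hQ₀⟩ := Filter.eventually_atTop.1 h
  refine ⟨?_, finite_near_rationals ξ Q₀ fun Q hQ p hpos => ?_⟩
  · rintro ⟨r, hr⟩
    have h1 := hQ₀ (r.den * (Q₀ + 1)) (by nlinarith [r.pos]) (r.num * (Q₀ + 1))
    have h2 : (((r.den * (Q₀ + 1) : ℕ) : ℝ)) * ξ - ((r.num * (Q₀ + 1) : ℤ) : ℝ) = 0 := by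
      rw [← hr]
      have : (r : ℝ) * r.den = r.num := by exact_mod_cast Rat.mul_den_eq_num r
      push_cast
      linear_combination (Q₀ + 1 : ℝ) * this
    rw [h2, abs_zero, mul_zero] at h1
    exact absurd h1 (not_le.2 (Real.exp_pos _))
  · have hQr : (0 : ℝ) < Q := by exact_mod_cast hpos
    have h1 := hQ₀ Q hQ p
    have h2 : |Q * ξ - p| = Q * |ξ - p / Q| := by
      rw [← abs_of_pos hQr, ← abs_mul, abs_of_pos hQr]
      congr 1
      field_simp
    rw [h2] at h1
    change (((Q : ℝ) ^ 2)⁻¹ * Real.exp (-K * sqrtLogLogLog Q)) ≤ _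
    rw [inv_mul_le_iff₀ (by positivity)]
    linarith

lemma HasLinearFormLowerBound.affine {K ξ : ℝ} (h : HasLinearFormLowerBound K ξ)
    (u v w : ℤ) (hw : 0 < w) {η : ℝ} (hη : η = (u + v * ξ) / w) (hv : |v| = 1) :
    HasLinearFormLowerBound (K + 1) η := by
  have hS := tendsto_sqrtLogLogLog.eventually_ge_atTop (Real.log w)
  filter_upwards [h, hS] with Q hQ hSQ p
  have hwr : (0 : ℝ) < w := by exact_mod_cast hw
  have h1 := hQ (v * (w * p - u * Q))
  have hv2 : (v : ℝ) * v = 1 := by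
    have : v * v = 1 := by rw [← abs_mul_abs_self, hv]; rfl
    exact_mod_cast this
  have hv' : |(v : ℝ)| = 1 := by exact_mod_cast hv
  have h2 : Q * ξ - ((v * (w * p - u * Q) : ℤ) : ℝ) = v * (w * (Q * η - p)) := by
    rw [hη]; push_cast; field_simp; linear_combination (-(Q : ℝ) * ξ) * hv2
  rw [h2, abs_mul, hv', one_mul, abs_mul, abs_of_pos hwr] at h1
  have h3 : Real.exp (-(K + 1) * sqrtLogLogLog Q) =
      Real.exp (-K * sqrtLogLogLog Q) * Real.exp (-sqrtLogLogLog Q) := by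
    rw [← Real.exp_add]; ring_nf
  have h4 : Real.exp (-sqrtLogLogLog Q) ≤ (w : ℝ)⁻¹ := by
    rw [← Real.exp_log hwr, ← Real.exp_neg]
    exact Real.exp_le_exp.2 (by simpa using hSQ)
  rw [h3]
  calc _ ≤ (Q * (w * |Q * η - p|)) * (w : ℝ)⁻¹ := by gcongr
    _ = _ := by field_simp

/-- Nonzero determinant criterion for linear forms. -/
lemma linear_form_lower_bound_of_det_ne_zero {ξ a : ℝ} {Q : ℕ} {p A P A' P' : ℤ} (hQ : 0 < Q)
    (hdet : A * P' ≠ A' * P) (hA : |(A : ℝ)| ≤ a) (hA' : |(A' : ℝ)| ≤ a)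
    (hL : Q * |A * ξ - P| ≤ 1 / 2) (hL' : Q * |A' * ξ - P'| ≤ 1 / 2) :
    1 / 2 ≤ a * |Q * ξ - p| := by
  have key : ∀ A P : ℤ, p * A - P * Q ≠ 0 → |(A : ℝ)| ≤ a → Q * |A * ξ - P| ≤ 1 / 2 →
      1 / 2 ≤ a * |Q * ξ - p| := by
    intro A P h1 h2 h3
    have h4 : (1 : ℝ) ≤ |((p * A - P * Q : ℤ) : ℝ)| := by
      exact_mod_cast Int.one_le_abs h1
    have h5 : ((p * A - P * Q : ℤ) : ℝ) = Q * (A * ξ - P) - A * (Q * ξ - p) := by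
      push_cast; ring
    rw [h5] at h4
    have h6 := h4.trans (abs_sub _ _)
    rw [abs_mul, abs_mul, Nat.abs_cast] at h6
    have h7 : |(A : ℝ)| * |Q * ξ - p| ≤ a * |Q * ξ - p| := by gcongr
    linarith
  by_cases h : p * A - P * Q = 0
  · refine key A' P' (fun h' => hdet ?_) hA' hL'
    have hQ' : (Q : ℤ) ≠ 0 := by exact_mod_cast hQ.ne'
    apply mul_right_cancel₀ hQ'
    linear_combination A' * h - A * h'
  · exact key A P h hA hL

lemma exists_pow_mul_mem_Icc {d : ℕ} (hd : 2 ≤ d) {β S : ℝ} (hβ : 0 < β) (hS : β ≤ S) :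
    ∃ t : ℕ, S ≤ (d : ℝ) ^ t * β ∧ (d : ℝ) ^ t * β ≤ d * S := by
  have hd' : (2 : ℝ) ≤ d := by exact_mod_cast hd
  have hex : ∃ t : ℕ, S ≤ (d : ℝ) ^ t * β := by
    obtain ⟨t, ht⟩ := pow_unbounded_of_one_lt (S / β) (show (1 : ℝ) < d by linarith)
    exact ⟨t, ((div_lt_iff₀ hβ).1 ht).le⟩
  classical
  refine ⟨Nat.find hex, Nat.find_spec hex, ?_⟩
  rcases h : Nat.find hex with _ | t
  · nlinarith
  · have := Nat.find_min hex (m := t) (by omega)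
    rw [pow_succ]
    nlinarith [not_le.1 this]

lemma exists_nat_mul_mem_Icc_log {C d l S X : ℝ} (hC : 0 ≤ C) (hd : 2 ≤ d) (hl : 1 ≤ l)
    (hS : 3 ≤ S) (hSS : S * S = l * Real.log l) (hsmall : (3 * C + 2 + 2 * d) * S ≤ l)
    (hSX : S ≤ X) (hXS : X ≤ d * S) :
    ∃ m : ℕ, 2 ≤ m ∧ l + (3 * C + 1) * S ≤ m * X ∧ m * X ≤ l + (3 * C + 1) * S + X ∧
      m * Real.log m ≤ 3 * S := by
  have hX : 0 < X := by linarith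
  set Y := l + (3 * C + 1) * S with hY
  have hYpos : 0 ≤ Y := by positivity
  have hCS : 0 ≤ C * S := by positivity
  have hdS : 2 * S ≤ d * S := by gcongr
  set m := ⌈Y / X⌉₊ with hm
  have hm1 : Y ≤ m * X := (div_le_iff₀ hX).1 (Nat.le_ceil _)
  have hm2 : m * X ≤ Y + X := by
    have := (Nat.ceil_lt_add_one (a := Y / X) (by positivity)).le
    have h2 := mul_le_mul_of_nonneg_right this hX.le
    rwa [add_mul, one_mul, div_mul_cancel₀ _ hX.ne'] at h2
  have hmS : m * S ≤ 3 * l := by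
    have h1 : (m - 1) * S ≤ Y := by
      rcases le_total (1 : ℝ) m with h | h
      · calc ((m : ℝ) - 1) * S ≤ (m - 1) * X := by
              apply mul_le_mul_of_nonneg_left hSX; linarith
          _ ≤ _ := by linarith
      · have : ((m : ℝ) - 1) * S ≤ 0 := mul_nonpos_of_nonpos_of_nonneg (by linarith) (by linarith)
        linarith
    linarith
  have hm2' : (1 : ℝ) < m := by
    by_contra hc
    have h2 : (m : ℝ) * X ≤ 1 * X := by gcongr; linarith
    linarith
  have hml : (m : ℝ) ≤ l := by
    have : (m : ℝ) * 3 ≤ m * S := by gcongr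
    linarith
  refine ⟨m, by exact_mod_cast hm2', hm1, hm2, ?_⟩
  have h1 : Real.log m ≤ Real.log l := Real.log_le_log (by linarith) hml
  have h2 : 0 ≤ Real.log l := Real.log_nonneg hl
  have h3 : (m * Real.log m) * S ≤ (3 * S) * S := by
    calc _ = (m * S) * Real.log m := by ring
      _ ≤ (m * S) * Real.log l := by gcongr
      _ ≤ (3 * l) * Real.log l := by gcongr
      _ = _ := by linear_combination -3 * hSS
  exact le_of_mul_le_mul_right h3 (by linarith)

/-- Families of pairs of integral approximations, of quality controlled by two parameters
`t` and `m`, give a lower bound for linear forms, with a constant that does not depend on the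
base `B`. -/
lemma exists_lower_bound_of_approximations {d : ℕ} (hd : 2 ≤ d) (C M : ℕ) :
    ∃ K : ℝ, 0 < K ∧ ∀ B ξ : ℝ, 2 ≤ B →
      (∀ t m : ℕ, 2 ≤ m → ∃ A P A' P' : ℤ, A * P' ≠ A' * P ∧
        |(A : ℝ)| ≤ (m : ℝ) ^ (C * m) * B ^ (d ^ t * (m + M)) ∧
        |(A' : ℝ)| ≤ (m : ℝ) ^ (C * m) * B ^ (d ^ t * (m + M)) ∧
        |A * ξ - P| ≤ (m : ℝ) ^ (C * m) / B ^ (d ^ t * m) ∧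
        |A' * ξ - P'| ≤ (m : ℝ) ^ (C * m) / B ^ (d ^ t * m)) →
      HasLinearFormLowerBound K ξ := by
  refine ⟨6 * C + 2 + d * (1 + M), by positivity, fun B ξ hB happ => ?_⟩
  have hlog : Filter.Tendsto (fun Q : ℕ => Real.log (Q : ℝ)) Filter.atTop Filter.atTop :=
    Real.tendsto_log_atTop.comp tendsto_natCast_atTop_atTop
  have hβ : 0 < Real.log B := Real.log_pos (by linarith)
  have hd' : (2 : ℝ) ≤ d := by exact_mod_cast hd
  filter_upwards [tendsto_sqrtLogLogLog.eventually_ge_atTop (max 3 (Real.log B)),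
    hlog.eventually (eventually_mul_sqrt_mul_log_le (3 * C + 2 + 2 * d)),
    hlog.eventually_ge_atTop 1, Filter.eventually_gt_atTop 0] with Q hS hsmall hl1 hQ p
  set l := Real.log (Q : ℝ) with hl
  set S := sqrtLogLogLog Q with hSdef
  change _ * S ≤ l at hsmall
  have hS3 : 3 ≤ S := (le_max_left _ _).trans hS
  have hSB : Real.log B ≤ S := (le_max_right _ _).trans hS
  have hSS : S * S = l * Real.log l :=
    Real.mul_self_sqrt (mul_nonneg (by linarith) (Real.log_nonneg hl1))
  obtain ⟨t, htS, htd⟩ := exists_pow_mul_mem_Icc hd hβ hSB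
  set X := (d : ℝ) ^ t * Real.log B with hX
  have hXpos : 0 < X := by linarith
  have hCpos : (0 : ℝ) ≤ C := Nat.cast_nonneg C
  obtain ⟨m, hm2n, hm1, hm2, hmlog⟩ :=
    exists_nat_mul_mem_Icc_log hCpos hd' hl1 hS3 hSS hsmall htS htd
  have hmpos : (0 : ℝ) < m := by exact_mod_cast (by omega : 0 < m)
  have hE : (m : ℝ) ^ (C * m) ≤ Real.exp (3 * C * S) := by
    rw [← Real.exp_log hmpos, ← Real.exp_nat_mul]
    apply Real.exp_le_exp.2
    push_cast
    calc _ = C * (m * Real.log m) := by ring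
      _ ≤ C * (3 * S) := by gcongr
      _ = _ := by ring
  have hBpow : ∀ n : ℕ, B ^ (d ^ t * n) = Real.exp (n * X) := by
    intro n
    conv_lhs => rw [← Real.exp_log (show (0 : ℝ) < B by linarith), ← Real.exp_nat_mul]
    rw [hX]
    push_cast
    ring_nf
  obtain ⟨A, P, A', P', hdet, hA, hA', hL, hL'⟩ := happ t m hm2n
  rw [hBpow] at hA hA' hL hL'
  have hQl : (Q : ℝ) = Real.exp l := by
    rw [hl, Real.exp_log (by exact_mod_cast hQ)]
  have hsm : Q * ((m : ℝ) ^ (C * m) / Real.exp (m * X)) ≤ 1 / 2 := by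
    calc _ ≤ Real.exp l * (Real.exp (3 * C * S) / Real.exp (m * X)) := by
          rw [← hQl]; gcongr
      _ = Real.exp (l + 3 * C * S - m * X) := by rw [Real.exp_sub, Real.exp_add]; ring
      _ ≤ Real.exp (-1) := Real.exp_le_exp.2 (by linarith)
      _ ≤ 1 / 2 := by
        rw [Real.exp_neg, one_div]
        exact inv_anti₀ (by norm_num) (by linarith [Real.add_one_le_exp (1 : ℝ)])
  have hbig : (m : ℝ) ^ (C * m) * Real.exp (((m + M : ℕ) : ℝ) * X) ≤
      Q * Real.exp ((6 * C + 1 + d * (1 + M)) * S) := by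
    calc _ ≤ Real.exp (3 * C * S) * Real.exp (((m + M : ℕ) : ℝ) * X) := by gcongr
      _ = Real.exp (3 * C * S + ((m + M : ℕ) : ℝ) * X) := by rw [Real.exp_add]
      _ ≤ Real.exp (l + (6 * C + 1 + d * (1 + M)) * S) := by
        apply Real.exp_le_exp.2
        push_cast
        have : (1 + M : ℝ) * X ≤ (1 + M) * (d * S) := by gcongr
        linarith
      _ = _ := by rw [Real.exp_add, ← hQl]
  have hfin := linear_form_lower_bound_of_det_ne_zero (p := p) hQ hdet (hA.trans hbig)
    (hA'.trans hbig) ((mul_le_mul_of_nonneg_left hL (by positivity)).trans hsm)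
    ((mul_le_mul_of_nonneg_left hL' (by positivity)).trans hsm)
  have hsplit : Real.exp (-(6 * C + 2 + d * (1 + M)) * S) =
      Real.exp (-S) * (Real.exp ((6 * C + 1 + d * (1 + M)) * S))⁻¹ := by
    rw [← Real.exp_neg, ← Real.exp_add]; ring_nf
  have hhalf : Real.exp (-S) ≤ 1 / 2 := by
    rw [Real.exp_neg, one_div]
    exact inv_anti₀ (by norm_num) (by linarith [Real.add_one_le_exp S])
  rw [hsplit, ← div_eq_mul_inv, div_le_iff₀ (Real.exp_pos _)]
  nlinarith

/-- The coefficients of the product `∏ P(w ^ (d ^ t))`. -/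
noncomputable def mahlerCoeff (d : ℕ) (P : ℤ[X]) (n : ℕ) : ℤ :=
  PowerSeries.coeff n (MahlerMeasure.productSeries d P)

lemma coeff_mul_expand {d : ℕ} {P : ℤ[X]} (hP : P.natDegree < d) (G : ℤ[X]) (n : ℕ) {r : ℕ}
    (hr : r < d) : (P * expand ℤ d G).coeff (d * n + r) = P.coeff r * G.coeff n := by
  have hd : 0 < d := by omega
  rw [coeff_mul, Finset.sum_eq_single (r, d * n)]
  · rw [coeff_expand hd, if_pos (dvd_mul_right _ _), Nat.mul_div_cancel_left _ hd]
  · rintro ⟨i, j⟩ hij hne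
    rw [Finset.HasAntidiagonal.mem_antidiagonal] at hij
    dsimp only at hij ⊢
    by_cases hi : i < d
    · rw [coeff_expand hd, if_neg, mul_zero]
      rintro ⟨j', rfl⟩
      have h1 : (i + d * j') % d = (d * n + r) % d := by rw [hij]
      rw [Nat.add_mul_mod_self_left, Nat.mul_add_mod, Nat.mod_eq_of_lt hi, Nat.mod_eq_of_lt hr]
        at h1
      subst h1
      exact hne (Prod.ext rfl (by dsimp only; omega))
    · rw [coeff_eq_zero_of_natDegree_lt (by omega), zero_mul]
  · intro h
    exact absurd (Finset.HasAntidiagonal.mem_antidiagonal.2 (add_comm _ _)) h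

lemma prod_range_succ_expand (d : ℕ) (P : ℤ[X]) (T : ℕ) :
    ∏ t ∈ Finset.range (T + 1), expand ℤ (d ^ t) P =
      P * expand ℤ d (∏ t ∈ Finset.range T, expand ℤ (d ^ t) P) := by
  rw [Finset.prod_range_succ', map_prod]
  simp only [pow_zero, expand_one, expand_expand, pow_succ']
  rw [mul_comm]

open scoped PowerSeries.WithPiTopology in
lemma tendsto_coeff_prod {d : ℕ} (hd : 2 ≤ d) {P : ℤ[X]} (hP : P.coeff 0 = 1) (n : ℕ) :
    Filter.Tendsto (fun T => (∏ t ∈ Finset.range T, expand ℤ (d ^ t) P).coeff n) Filter.atTop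
      (nhds (mahlerCoeff d P n)) := by
  have h := (MahlerMeasure.multipliable_productSeries hd hP).hasProd.tendsto_prod_nat
  have h2 := ((PowerSeries.WithPiTopology.continuous_coeff ℤ n).tendsto _).comp h
  refine h2.congr fun T => ?_
  simp only [Function.comp]
  have e : ((∏ t ∈ Finset.range T, expand ℤ (d ^ t) P : ℤ[X]) : PowerSeries ℤ) =
      ∏ t ∈ Finset.range T, ((expand ℤ (d ^ t) P : ℤ[X]) : PowerSeries ℤ) := by
    have := map_prod (Polynomial.coeToPowerSeries.ringHom (R := ℤ))
      (fun t => expand ℤ (d ^ t) P) (Finset.range T)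
    simpa only [Polynomial.coeToPowerSeries.ringHom_apply] using this
  rw [← Polynomial.coeff_coe, e]

lemma mahlerCoeff_mul_add {d : ℕ} (hd : 2 ≤ d) {P : ℤ[X]} (hP : P.coeff 0 = 1)
    (hdeg : P.natDegree < d) (n : ℕ) {r : ℕ} (hr : r < d) :
    mahlerCoeff d P (d * n + r) = P.coeff r * mahlerCoeff d P n := by
  have h1 := (tendsto_coeff_prod hd hP (d * n + r)).comp (Filter.tendsto_add_atTop_nat 1)
  have h2 := (tendsto_coeff_prod hd hP n).const_mul (P.coeff r)
  refine tendsto_nhds_unique h1 (h2.congr fun T => ?_)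
  simp only [Function.comp]
  rw [prod_range_succ_expand, coeff_mul_expand hdeg _ _ hr]

lemma mahlerCoeff_zero {d : ℕ} (hd : 2 ≤ d) {P : ℤ[X]} (hP : P.coeff 0 = 1) :
    mahlerCoeff d P 0 = 1 := by
  refine tendsto_nhds_unique (tendsto_coeff_prod hd hP 0) ?_
  refine tendsto_const_nhds.congr fun T => ?_
  simp only [coeff_zero_eq_eval_zero, eval_prod, expand_eval]
  rw [Finset.prod_eq_one]
  intro t _
  rw [zero_pow (by positivity), ← coeff_zero_eq_eval_zero, hP]

lemma exists_abs_mahlerCoeff_le {d : ℕ} (hd : 2 ≤ d) {P : ℤ[X]} (hP : P.coeff 0 = 1)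
    (hdeg : P.natDegree < d) :
    ∃ C : ℕ, ∀ n, |mahlerCoeff d P n| ≤ (2 * (n + 1)) ^ C := by
  obtain ⟨C, hC⟩ : ∃ C : ℕ, ∀ r, |P.coeff r| ≤ 2 ^ C := by
    refine ⟨(∑ r ∈ Finset.range d, |P.coeff r|).toNat, fun r => ?_⟩
    have h0 : ∀ r, 0 ≤ |P.coeff r| := fun r => abs_nonneg _
    have h1 : |P.coeff r| ≤ ∑ r ∈ Finset.range d, |P.coeff r| := by
      by_cases hr : r < d
      · exact Finset.single_le_sum (f := fun r => |P.coeff r|) (fun r _ => h0 r)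
          (Finset.mem_range.2 hr)
      · rw [coeff_eq_zero_of_natDegree_lt (by omega), abs_zero]
        exact Finset.sum_nonneg fun r _ => h0 r
    refine h1.trans ((Int.self_le_toNat _).trans ?_)
    exact_mod_cast (Nat.lt_two_pow_self).le
  have key : ∀ n : ℕ, 1 ≤ n → |mahlerCoeff d P n| ≤ (2 * n) ^ C := by
    intro n
    induction n using Nat.strong_induction_on with
    | _ n ih =>
      intro hn
      have hdn : d * (n / d) + n % d = n := Nat.div_add_mod n d
      have h1 : |mahlerCoeff d P n| ≤ 2 ^ C * |mahlerCoeff d P (n / d)| := by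
        conv_lhs => rw [← hdn, mahlerCoeff_mul_add hd hP hdeg _ (Nat.mod_lt n (by omega)), abs_mul]
        gcongr
        exact hC _
      by_cases hnd : n < d
      · rw [Nat.div_eq_of_lt hnd, mahlerCoeff_zero hd hP, abs_one, mul_one] at h1
        refine h1.trans (pow_le_pow_left₀ (by norm_num) ?_ C)
        exact_mod_cast (by omega : 2 ≤ 2 * n)
      · have hpos : 1 ≤ n / d := (Nat.one_le_div_iff (by omega)).2 (by omega)
        have h2 := ih (n / d) (Nat.div_lt_self (by omega) (by omega)) hpos
        have h3 : 2 * (n / d) ≤ n := by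
          calc 2 * (n / d) ≤ d * (n / d) := by gcongr
            _ ≤ n := Nat.mul_div_le n d
        calc _ ≤ 2 ^ C * |mahlerCoeff d P (n / d)| := h1
          _ ≤ 2 ^ C * (2 * ((n / d : ℕ) : ℤ)) ^ C := by gcongr
          _ ≤ 2 ^ C * (n : ℤ) ^ C := by gcongr; exact_mod_cast h3
          _ = _ := by rw [mul_pow]
  refine ⟨C, fun n => ?_⟩
  rcases Nat.eq_zero_or_pos n with rfl | hn
  · rw [mahlerCoeff_zero hd hP, abs_one]
    exact one_le_pow₀ (by norm_num)
  · exact (key n hn).trans (pow_le_pow_left₀ (by positivity) (by linarith) C)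

lemma sum_range_mul_eq {R : Type*} [AddCommMonoid R] (f : ℕ → R) (d n : ℕ) :
    ∑ i ∈ Finset.range (d * n), f i =
      ∑ j ∈ Finset.range n, ∑ r ∈ Finset.range d, f (d * j + r) := by
  induction n with
  | zero => simp
  | succ n ih => rw [mul_add, mul_one, Finset.sum_range_add, ih, Finset.sum_range_succ]

lemma prod_range_aeval_eq_sum {d : ℕ} (hd : 2 ≤ d) {P : ℤ[X]} (hP : P.coeff 0 = 1)
    (hdeg : P.natDegree < d) (T : ℕ) (x : ℝ) :
    ∏ t ∈ Finset.range T, aeval (x ^ (d ^ t)) P =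
      ∑ n ∈ Finset.range (d ^ T), (mahlerCoeff d P n : ℝ) * x ^ n := by
  induction T generalizing x with
  | zero => simp [mahlerCoeff_zero hd hP]
  | succ T ih =>
    rw [Finset.prod_range_succ', pow_succ', sum_range_mul_eq]
    simp_rw [pow_succ' d, pow_mul]
    rw [ih (x ^ d), pow_zero, pow_one, aeval_eq_sum_range' hdeg, Finset.sum_mul]
    refine Finset.sum_congr rfl fun j _ => ?_
    rw [Finset.mul_sum]
    refine Finset.sum_congr rfl fun r hr => ?_
    rw [mahlerCoeff_mul_add hd hP hdeg _ (Finset.mem_range.1 hr), pow_add, pow_mul, zsmul_eq_mul]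
    push_cast
    ring

lemma summable_poly_geometric (C : ℕ) :
    Summable fun n : ℕ => ((n : ℝ) + 1) ^ C * (1 / 2 : ℝ) ^ n := by
  have h := summable_pow_mul_geometric_of_norm_lt_one (R := ℝ) C (r := 1 / 2) (by norm_num)
  have h2 := ((summable_nat_add_iff 1).2 h).mul_left 2
  refine h2.congr fun n => ?_
  push_cast
  ring

/-- The constant `∑ (n + 1) ^ C / 2 ^ n`. -/
noncomputable def polyGeomSum (C : ℕ) : ℝ := ∑' n : ℕ, ((n : ℝ) + 1) ^ C * (1 / 2 : ℝ) ^ n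

lemma norm_term_le {c : ℕ → ℤ} {C : ℕ} (hc : ∀ n, |c n| ≤ (2 * (n + 1)) ^ C) {x : ℝ}
    (hx : |x| ≤ 1 / 2) (n : ℕ) :
    ‖(c n : ℝ) * x ^ n‖ ≤ 2 ^ C * (((n : ℝ) + 1) ^ C * (1 / 2 : ℝ) ^ n) := by
  rw [norm_mul, norm_pow, Real.norm_eq_abs, Real.norm_eq_abs, ← mul_assoc, ← mul_pow]
  have : |(c n : ℝ)| ≤ (2 * (n + 1)) ^ C := by exact_mod_cast hc n
  gcongr

lemma summable_coeff_mul_pow {c : ℕ → ℤ} {C : ℕ} (hc : ∀ n, |c n| ≤ (2 * (n + 1)) ^ C) {x : ℝ}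
    (hx : |x| ≤ 1 / 2) : Summable fun n : ℕ => (c n : ℝ) * x ^ n :=
  Summable.of_norm_bounded ((summable_poly_geometric C).mul_left _) (norm_term_le hc hx)

lemma abs_inv_le_half {b : ℤ} (hb : 2 ≤ |b|) : |((b : ℝ))⁻¹| ≤ 1 / 2 := by
  have hb' : (2 : ℝ) ≤ |(b : ℝ)| := by exact_mod_cast hb
  rw [abs_inv, one_div]
  exact inv_anti₀ (by norm_num) hb'

lemma mahlerValue_eq_tsum {d : ℕ} (hd : 2 ≤ d) {P : ℤ[X]} (hP : P.coeff 0 = 1)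
    (hdeg : P.natDegree < d) {b : ℤ} (hb : 2 ≤ |b|) :
    MahlerMeasure.mahlerValue d P b = ∑' n : ℕ, (mahlerCoeff d P n : ℝ) * ((b : ℝ)⁻¹) ^ n := by
  obtain ⟨C, hC⟩ := exists_abs_mahlerCoeff_le hd hP hdeg
  have h1 := (MahlerMeasure.multipliable_mahlerValue hd hP hb).hasProd.tendsto_prod_nat
  have h2 := (summable_coeff_mul_pow hC (abs_inv_le_half hb)).hasSum.tendsto_sum_nat
  refine tendsto_nhds_unique h1 ((h2.comp (tendsto_pow_atTop_atTop_of_one_lt hd)).congr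
    fun T => ?_)
  simp only [Function.comp]
  rw [← prod_range_aeval_eq_sum hd hP hdeg]
  simp_rw [inv_pow]

lemma two_le_abs_pow {b : ℤ} (hb : 2 ≤ |b|) {n : ℕ} (hn : n ≠ 0) : 2 ≤ |b ^ n| := by
  rw [abs_pow]
  exact hb.trans (le_self_pow₀ (by linarith) hn)

lemma mahlerValue_eq_mul {d : ℕ} (hd : 2 ≤ d) {P : ℤ[X]} (hP : P.coeff 0 = 1)
    (hdeg : P.natDegree < d) {b : ℤ} (hb : 2 ≤ |b|) (t : ℕ) :
    MahlerMeasure.mahlerValue d P b =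
      (∑ n ∈ Finset.range (d ^ t), (mahlerCoeff d P n : ℝ) * ((b : ℝ)⁻¹) ^ n) *
        MahlerMeasure.mahlerValue d P (b ^ (d ^ t)) := by
  have h := MahlerMeasure.multipliable_mahlerValue hd hP (two_le_abs_pow hb
    (pow_ne_zero t (by omega : d ≠ 0)))
  rw [← prod_range_aeval_eq_sum hd hP hdeg]
  have h3 : (fun s : ℕ => aeval (((((b ^ d ^ t : ℤ)) : ℝ) ^ (d ^ s))⁻¹) P) =
      fun s : ℕ => aeval (((b : ℝ) ^ (d ^ (s + t)))⁻¹) P := by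
    funext s
    push_cast
    rw [← pow_mul, ← pow_add, add_comm]
  unfold MahlerMeasure.mahlerValue
  rw [h3] at h ⊢
  rw [← Multipliable.prod_mul_tprod_nat_mul' (f := fun s : ℕ => aeval (((b : ℝ) ^ (d ^ s))⁻¹) P)
    (k := t) h]
  simp_rw [inv_pow]

namespace MahlerMeasure

lemma ofPoly_monomial (n : ℕ) (a : ℚ) :
    ofPoly (monomial n a) = HahnSeries.single (-(n : ℤ)) a := by
  rw [ofPoly, aeval_monomial, HahnSeries.single_pow,
    show algebraMap ℚ (LaurentSeries ℚ) = HahnSeries.C from Subsingleton.elim _ _,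
    HahnSeries.C_apply, HahnSeries.single_mul_single]
  simp

lemma coeff_ofPoly_neg (q : ℚ[X]) (n : ℕ) : (ofPoly q).coeff (-(n : ℤ)) = q.coeff n := by
  induction q using Polynomial.induction_on' with
  | add p q hp hq => rw [map_add, HahnSeries.coeff_add, hp, hq, coeff_add]
  | monomial m a =>
    rw [ofPoly_monomial, HahnSeries.coeff_single, coeff_monomial]
    simp [eq_comm]

lemma coeff_ofPoly_pos (q : ℚ[X]) {j : ℤ} (hj : 0 < j) : (ofPoly q).coeff j = 0 := by
  induction q using Polynomial.induction_on' with
  | add p q hp hq => rw [map_add, HahnSeries.coeff_add, hp, hq, add_zero]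
  | monomial m a =>
    rw [ofPoly_monomial, HahnSeries.coeff_single, if_neg]
    omega

lemma ofPoly_ne_zero {q : ℚ[X]} (hq : q ≠ 0) : ofPoly q ≠ 0 := by
  intro h
  apply hq
  ext n
  rw [← coeff_ofPoly_neg, h]
  simp

lemma order_ofPoly {q : ℚ[X]} (hq : q ≠ 0) : (ofPoly q).order = -(q.natDegree : ℤ) := by
  apply le_antisymm
  · apply HahnSeries.order_le_of_coeff_ne_zero
    rw [coeff_ofPoly_neg]
    exact leadingCoeff_ne_zero.2 hq
  · rw [HahnSeries.le_order_iff_forall (ofPoly_ne_zero hq)]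
    intro j hj
    obtain ⟨n, rfl⟩ : ∃ n : ℕ, j = -(n : ℤ) := ⟨(-j).toNat, by omega⟩
    rw [coeff_ofPoly_neg, coeff_eq_zero_of_natDegree_lt (by omega)]

lemma coeff_polyPart (x : LaurentSeries ℚ) (i : ℕ) :
    (polyPart x).coeff i = x.coeff (-(i : ℤ)) := by
  simp only [polyPart, finsetSum_coeff, coeff_monomial, Finset.sum_ite_eq', Finset.mem_range]
  split_ifs with h
  · rfl
  · rw [HahnSeries.coeff_eq_zero_of_lt_order]
    omega

lemma coeff_sub_polyPart (x : LaurentSeries ℚ) {j : ℤ} (hj : j ≤ 0) :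
    (x - ofPoly (polyPart x)).coeff j = 0 := by
  obtain ⟨n, rfl⟩ : ∃ n : ℕ, j = -(n : ℤ) := ⟨(-j).toNat, by omega⟩
  rw [HahnSeries.coeff_sub, coeff_ofPoly_neg, coeff_polyPart, sub_self]

lemma one_le_order_sub_polyPart {x : LaurentSeries ℚ} (hx : x ≠ ofPoly (polyPart x)) :
    1 ≤ (x - ofPoly (polyPart x)).order := by
  rw [HahnSeries.le_order_iff_forall (sub_ne_zero.2 hx)]
  intro j hj
  exact coeff_sub_polyPart x (by omega)

lemma natDegree_polyPart {x : LaurentSeries ℚ} (hx : x ≠ 0) (h : x.order ≤ 0) :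
    ((polyPart x).natDegree : ℤ) = -x.order := by
  have h1 : (polyPart x).natDegree = (-x.order).toNat := by
    apply natDegree_eq_of_le_of_coeff_ne_zero
    · rw [natDegree_le_iff_coeff_eq_zero]
      intro n hn
      rw [coeff_polyPart, HahnSeries.coeff_eq_zero_of_lt_order]
      omega
    · rw [coeff_polyPart, Int.toNat_of_nonneg (by omega), neg_neg]
      exact fun h => hx (HahnSeries.coeff_order_eq_zero.1 h)
  omega

lemma order_inv {x : LaurentSeries ℚ} (hx : x ≠ 0) : x⁻¹.order = -x.order := by
  have h := HahnSeries.order_mul hx (inv_ne_zero hx)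
  rw [mul_inv_cancel₀ hx, HahnSeries.order_one] at h
  linarith

/-! ### Convergents -/

/-- Numerators of the convergents, with index shifted by one. -/
noncomputable def convNum (x : LaurentSeries ℚ) : ℕ → ℚ[X]
  | 0 => 1
  | 1 => partialQuotient x 0
  | n + 2 => partialQuotient x (n + 1) * convNum x (n + 1) + convNum x n

/-- Denominators of the convergents, with index shifted by one. -/
noncomputable def convDen (x : LaurentSeries ℚ) : ℕ → ℚ[X]
  | 0 => 0
  | 1 => 1
  | n + 2 => partialQuotient x (n + 1) * convDen x (n + 1) + convDen x n

/-- The remainders `qₙ x - pₙ`. -/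
noncomputable def convRem (x : LaurentSeries ℚ) (n : ℕ) : LaurentSeries ℚ :=
  ofPoly (convDen x n) * x - ofPoly (convNum x n)

lemma convNum_mul_convDen_sub (x : LaurentSeries ℚ) (n : ℕ) :
    convNum x (n + 1) * convDen x n - convNum x n * convDen x (n + 1) = (-1) ^ (n + 1) := by
  induction n with
  | zero => simp [convNum, convDen]
  | succ n ih =>
    rw [convNum, convDen, pow_succ, ← ih]
    ring

lemma completeQuotient_succ_ne_zero {x : LaurentSeries ℚ} {n : ℕ}
    (h : completeQuotient x n ≠ ofPoly (partialQuotient x n)) :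
    completeQuotient x (n + 1) ≠ 0 := by
  rw [completeQuotient]
  exact inv_ne_zero (sub_ne_zero.2 h)

lemma completeQuotient_succ_mul {x : LaurentSeries ℚ} {n : ℕ}
    (h : completeQuotient x n ≠ ofPoly (partialQuotient x n)) :
    completeQuotient x (n + 1) * (completeQuotient x n - ofPoly (partialQuotient x n)) = 1 := by
  rw [completeQuotient]
  exact inv_mul_cancel₀ (sub_ne_zero.2 h)

lemma natDegree_partialQuotient_succ {x : LaurentSeries ℚ} {n : ℕ}
    (h : completeQuotient x n ≠ ofPoly (partialQuotient x n)) :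
    1 ≤ (partialQuotient x (n + 1)).natDegree ∧
      ((partialQuotient x (n + 1)).natDegree : ℤ) = -(completeQuotient x (n + 1)).order := by
  have h1 := one_le_order_sub_polyPart h
  have h2 : (completeQuotient x (n + 1)).order ≤ -1 := by
    rw [partialQuotient] at h
    rw [completeQuotient, order_inv (sub_ne_zero.2 h)]
    exact neg_le_neg h1
  have h3 := natDegree_polyPart (completeQuotient_succ_ne_zero h) (by linarith)
  refine ⟨?_, h3⟩
  rw [partialQuotient]
  omega

lemma convRem_succ_succ (x : LaurentSeries ℚ) (n : ℕ) :
    convRem x (n + 2) = ofPoly (partialQuotient x (n + 1)) * convRem x (n + 1) + convRem x n := by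
  simp only [convRem, convNum, convDen, map_add, map_mul]
  ring

lemma convRem_succ_mul {x : LaurentSeries ℚ} {n : ℕ}
    (h : ∀ i ≤ n, completeQuotient x i ≠ ofPoly (partialQuotient x i)) :
    convRem x (n + 1) * completeQuotient x (n + 1) = -convRem x n := by
  induction n with
  | zero =>
    have h1 := completeQuotient_succ_mul (h 0 le_rfl)
    have h2 : completeQuotient x 0 = x := rfl
    rw [h2] at h1
    simp only [convRem, convDen, convNum, map_one, map_zero]
    linear_combination h1
  | succ n ih =>
    have h1 := completeQuotient_succ_mul (h (n + 1) le_rfl)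
    have h2 := ih fun i hi => h i (by omega)
    rw [convRem_succ_succ]
    linear_combination (-convRem x (n + 1)) * h1 + completeQuotient x (n + 1 + 1) * h2

lemma convRem_ne_zero {x : LaurentSeries ℚ} {n : ℕ}
    (h : ∀ i < n, completeQuotient x i ≠ ofPoly (partialQuotient x i)) :
    convRem x n ≠ 0 := by
  induction n with
  | zero => simp [convRem, convDen, convNum]
  | succ n ih =>
    intro h0
    have h1 := convRem_succ_mul (n := n) fun i hi => h i (by omega)
    rw [h0, zero_mul] at h1
    exact ih (fun i hi => h i (by omega)) (neg_eq_zero.1 h1.symm)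

lemma natDegree_convDen {x : LaurentSeries ℚ} {n : ℕ}
    (h : ∀ i < n, completeQuotient x i ≠ ofPoly (partialQuotient x i)) :
    convDen x (n + 1) ≠ 0 ∧ (convDen x n).degree < (convDen x (n + 1)).degree ∧
      (0 < n → (convDen x (n + 1)).natDegree =
        (convDen x n).natDegree + (partialQuotient x n).natDegree) := by
  induction n with
  | zero => simp [convDen]
  | succ n ih =>
    obtain ⟨h1, h2, -⟩ := ih fun i hi => h i (by omega)
    obtain ⟨h3, -⟩ := natDegree_partialQuotient_succ (h n (by omega))
    have ha : partialQuotient x (n + 1) ≠ 0 := by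
      intro h0; rw [h0] at h3; simp at h3
    have h4 : (convDen x (n + 1)).degree <
        (partialQuotient x (n + 1) * convDen x (n + 1)).degree := by
      rw [degree_mul, degree_eq_natDegree h1, degree_eq_natDegree ha]
      exact_mod_cast (by omega)
    have h5 : (convDen x (n + 2)).degree =
        (partialQuotient x (n + 1) * convDen x (n + 1)).degree := by
      rw [convDen]
      exact degree_add_eq_left_of_degree_lt (h2.trans h4)
    have h6 : convDen x (n + 2) ≠ 0 := by
      intro h0
      rw [h0, degree_zero] at h5
      rw [← h5] at h4
      exact not_lt_bot h4
    refine ⟨h6, by rw [h5]; exact h4, fun _ => ?_⟩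
    rw [natDegree_eq_of_degree_eq h5, natDegree_mul ha h1, add_comm]

lemma order_convRem {x : LaurentSeries ℚ} {n : ℕ}
    (h : ∀ i < n, completeQuotient x i ≠ ofPoly (partialQuotient x i)) (hn : 0 < n) :
    (convRem x n).order =
      ((convDen x n).natDegree + (partialQuotient x n).natDegree : ℤ) := by
  induction n with
  | zero => omega
  | succ n ih =>
    have h1 := convRem_succ_mul (n := n) fun i hi => h i (by omega)
    have h2 := HahnSeries.order_mul (convRem_ne_zero h)
      (completeQuotient_succ_ne_zero (h n (by omega)))
    rw [h1, HahnSeries.order_neg] at h2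
    have h3 := (natDegree_partialQuotient_succ (h n (by omega))).2
    rcases Nat.eq_zero_or_pos n with rfl | hpos
    · have : (convRem x 0).order = 0 := by
        simp [convRem, convDen, convNum, HahnSeries.order_neg, HahnSeries.order_one]
      rw [this] at h2
      simp only [convDen, natDegree_one]
      push_cast
      linarith
    · rw [ih (fun i hi => h i (by omega)) hpos] at h2
      have h4 := (natDegree_convDen (n := n) fun i hi => h i (by omega)).2.2 hpos
      rw [h4]
      push_cast
      linarith

/-- A Liouville inequality for `x` makes its continued fraction infinite with bounded partial
quotients. -/
lemma isBadlyApproximableSeries_of_liouville {x : LaurentSeries ℚ} (M : ℕ)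
    (h : ∀ q p : ℚ[X], q ≠ 0 →
      ∃ j : ℤ, j ≤ q.natDegree + M ∧ (ofPoly q * x - ofPoly p).coeff j ≠ 0) :
    IsBadlyApproximableSeries x := by
  have hinf : HasInfiniteContFract x := by
    intro n
    induction n using Nat.strong_induction_on with
    | _ n ih =>
      intro h0
      have h1 : convRem x (n + 1) = 0 := by
        rcases n with _ | n
        · simp only [convRem, convDen, convNum, map_one, one_mul, sub_eq_zero]
          exact h0
        · have h2 := convRem_succ_mul (n := n) fun i hi => ih i (by omega)
          rw [convRem_succ_succ, ← h0]
          linear_combination h2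
      obtain ⟨j, -, hj⟩ := h (convDen x (n + 1)) (convNum x (n + 1)) (natDegree_convDen ih).1
      exact hj (by rw [convRem] at h1; rw [h1]; simp)
  refine ⟨hinf, max M (partialQuotient x 0).natDegree, fun n => ?_⟩
  rcases n with _ | n
  · exact le_max_right _ _
  · obtain ⟨j, hj, hj'⟩ := h (convDen x (n + 1)) (convNum x (n + 1))
      (natDegree_convDen fun i _ => hinf i).1
    have h1 := order_convRem (n := n + 1) (fun i _ => hinf i) (by omega)
    have h2 : (convRem x (n + 1)).order ≤ j := HahnSeries.order_le_of_coeff_ne_zero hj'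
    refine le_trans ?_ (le_max_left _ _)
    omega

lemma exists_convDen_natDegree {x : LaurentSeries ℚ} {M : ℕ} (hinf : HasInfiniteContFract x)
    (hM : ∀ n, (partialQuotient x n).natDegree ≤ M) (m : ℕ) :
    ∃ n, 0 < n ∧ m < (convDen x n).natDegree ∧ (convDen x n).natDegree ≤ m + M ∧
      m < (convDen x (n + 1)).natDegree ∧ (convDen x (n + 1)).natDegree ≤ m + 2 * M := by
  have hstep : ∀ n, (convDen x (n + 1 + 1)).natDegree =
      (convDen x (n + 1)).natDegree + (partialQuotient x (n + 1)).natDegree := fun n =>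
    (natDegree_convDen (n := n + 1) fun i _ => hinf i).2.2 (by omega)
  have hpos : ∀ n, 1 ≤ (partialQuotient x (n + 1)).natDegree := fun n =>
    (natDegree_partialQuotient_succ (hinf n)).1
  have hex : ∃ n, m < (convDen x (n + 1)).natDegree := by
    have : ∀ n, n ≤ (convDen x (n + 1)).natDegree := by
      intro n
      induction n with
      | zero => omega
      | succ n ih => have := hstep n; have := hpos n; omega
    exact ⟨m + 1, this _⟩
  classical
  obtain ⟨n, hn, hmin⟩ : ∃ n, m < (convDen x (n + 1)).natDegree ∧
      ∀ k < n, ¬ m < (convDen x (k + 1)).natDegree :=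
    ⟨Nat.find hex, Nat.find_spec hex, fun k hk => Nat.find_min hex hk⟩
  rcases n with _ | n
  · simp [convDen] at hn
  · have h1 := hmin n (by omega)
    have h2 := hstep n
    have h3 := hstep (n + 1)
    have h4 := hpos (n + 1)
    have h5 := hM (n + 1)
    have h6 := hM (n + 1 + 1)
    exact ⟨n + 1 + 1, by omega, by omega, by omega, by omega, by omega⟩

/-- Uniqueness of Padé approximants at the degrees of the denominators of convergents. -/
lemma exists_eq_C_mul_convergent {x : LaurentSeries ℚ} (hinf : HasInfiniteContFract x) {n : ℕ}
    (hn : 0 < n) {q p : ℚ[X]} (hq : q ≠ 0) (hdeg : q.natDegree ≤ (convDen x n).natDegree)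
    (hrem : ∀ j : ℤ, j ≤ (convDen x n).natDegree → (ofPoly q * x - ofPoly p).coeff j = 0) :
    ∃ c : ℚ, c ≠ 0 ∧ q = C c * convDen x n ∧ p = C c * convNum x n := by
  obtain ⟨n, rfl⟩ : ∃ k, n = k + 1 := ⟨n - 1, by omega⟩
  set k := (convDen x (n + 1)).natDegree with hk
  have hden : convDen x (n + 1) ≠ 0 := (natDegree_convDen fun i _ => hinf i).1
  have hR := order_convRem (n := n + 1) (fun i _ => hinf i) (by omega)
  have hRpos := (natDegree_partialQuotient_succ (hinf n)).1
  have hRne := convRem_ne_zero (n := n + 1) fun i _ => hinf i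
  have hcross : q * convNum x (n + 1) - p * convDen x (n + 1) = 0 := by
    by_contra hD
    have h1 : ofPoly (q * convNum x (n + 1) - p * convDen x (n + 1)) =
        ofPoly (convDen x (n + 1)) * (ofPoly q * x - ofPoly p) -
          ofPoly q * convRem x (n + 1) := by
      simp only [convRem, map_sub, map_mul]; ring
    have h2 : (ofPoly (convDen x (n + 1)) * (ofPoly q * x - ofPoly p)).orderTop ≥
        ((1 : ℤ) : WithTop ℤ) := by
      by_cases h0 : ofPoly q * x - ofPoly p = 0
      · simp [h0]
      · rw [← HahnSeries.order_eq_orderTop_of_ne_zero (mul_ne_zero (ofPoly_ne_zero hden) h0),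
          HahnSeries.order_mul (ofPoly_ne_zero hden) h0, order_ofPoly hden]
        have : (k : ℤ) + 1 ≤ (ofPoly q * x - ofPoly p).order := by
          rw [HahnSeries.le_order_iff_forall h0]
          intro j hj
          exact hrem j (by omega)
        exact_mod_cast (by omega)
    have h3 : (ofPoly q * convRem x (n + 1)).orderTop ≥ ((1 : ℤ) : WithTop ℤ) := by
      rw [← HahnSeries.order_eq_orderTop_of_ne_zero (mul_ne_zero (ofPoly_ne_zero hq) hRne),
          HahnSeries.order_mul (ofPoly_ne_zero hq) hRne, order_ofPoly hq, hR]
      exact_mod_cast (by omega)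
    have h4 : ((1 : ℤ) : WithTop ℤ) ≤
        (ofPoly (q * convNum x (n + 1) - p * convDen x (n + 1))).orderTop := by
      rw [h1]
      exact (le_min h2 h3).trans HahnSeries.min_orderTop_le_orderTop_sub
    rw [← HahnSeries.order_eq_orderTop_of_ne_zero (ofPoly_ne_zero hD), order_ofPoly hD] at h4
    have h5 : (1 : ℤ) ≤ -((q * convNum x (n + 1) - p * convDen x (n + 1)).natDegree : ℤ) := by
      exact_mod_cast h4
    omega
  have hcop : IsCoprime (convDen x (n + 1)) (convNum x (n + 1)) := by
    refine ⟨(-1) ^ (n + 1) * (-convNum x n), (-1) ^ (n + 1) * convDen x n, ?_⟩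
    have h1 := convNum_mul_convDen_sub x n
    have h2 : ((-1 : ℚ[X]) ^ (n + 1)) * (-1) ^ (n + 1) = 1 := by
      rw [← mul_pow]; simp
    linear_combination (-1) ^ (n + 1) * h1 + h2
  obtain ⟨g, hg⟩ : convDen x (n + 1) ∣ q :=
    hcop.dvd_of_dvd_mul_right ⟨p, by linear_combination hcross⟩
  have hg0 : g ≠ 0 := by rintro rfl; exact hq (by rw [hg, mul_zero])
  have hgdeg : g.natDegree = 0 := by
    rw [hg, natDegree_mul hden hg0] at hdeg
    omega
  obtain ⟨c, rfl⟩ : ∃ c, g = C c := ⟨_, eq_C_of_natDegree_eq_zero hgdeg⟩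
  refine ⟨c, fun h => hg0 (by rw [h, C_0]), by rw [hg, mul_comm], ?_⟩
  apply mul_right_cancel₀ hden
  rw [hg] at hcross
  linear_combination -hcross

lemma pade_det_eval_ne_zero {x : LaurentSeries ℚ} (hinf : HasInfiniteContFract x) {n : ℕ}
    (hn : 0 < n) {q p q' p' : ℚ[X]} (hq : q ≠ 0) (hq' : q' ≠ 0)
    (hdeg : q.natDegree ≤ (convDen x n).natDegree)
    (hdeg' : q'.natDegree ≤ (convDen x (n + 1)).natDegree)
    (hrem : ∀ j : ℤ, j ≤ (convDen x n).natDegree → (ofPoly q * x - ofPoly p).coeff j = 0)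
    (hrem' : ∀ j : ℤ, j ≤ (convDen x (n + 1)).natDegree →
      (ofPoly q' * x - ofPoly p').coeff j = 0) (z : ℚ) :
    q.eval z * p'.eval z - q'.eval z * p.eval z ≠ 0 := by
  obtain ⟨c, hc, rfl, rfl⟩ := exists_eq_C_mul_convergent hinf hn hq hdeg hrem
  obtain ⟨c', hc', rfl, rfl⟩ := exists_eq_C_mul_convergent hinf (by omega) hq' hdeg' hrem'
  have h1 := congrArg (eval z) (convNum_mul_convDen_sub x n)
  simp only [eval_sub, eval_mul, eval_pow, eval_neg, eval_one, eval_C] at h1 ⊢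
  have h2 : c * eval z (convDen x n) * (c' * eval z (convNum x (n + 1))) -
      c' * eval z (convDen x (n + 1)) * (c * eval z (convNum x n)) =
      c * c' * (-1) ^ (n + 1) := by
    linear_combination c * c' * h1
  rw [h2]
  exact mul_ne_zero (mul_ne_zero hc hc') (pow_ne_zero _ (by norm_num))

/-! ### Padé approximants with small integral coefficients -/

/-- The polynomial part of `z ^ i * ∑ cₙ z⁻ⁿ`. -/
noncomputable def shiftPoly (c : ℕ → ℤ) : ℕ → ℤ[X]
  | 0 => C (c 0)
  | i + 1 => X * shiftPoly c i + C (c (i + 1))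

/-- The polynomial `∑ vᵢ zⁱ` of degree at most `k`. -/
noncomputable def padeDen (v : ℕ → ℤ) (k : ℕ) : ℤ[X] :=
  ∑ i ∈ Finset.range (k + 1), C (v i) * X ^ i

/-- The polynomial part of `(∑ vᵢ zⁱ) * ∑ cₙ z⁻ⁿ`. -/
noncomputable def padeNum (c v : ℕ → ℤ) (k : ℕ) : ℤ[X] :=
  ∑ i ∈ Finset.range (k + 1), C (v i) * shiftPoly c i

lemma map_C_int (a : ℤ) : (C a).map (Int.castRingHom ℚ) = C (a : ℚ) := by simp

lemma aeval_C_int (z : ℝ) (a : ℤ) : aeval z (C a) = (a : ℝ) := by simp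

lemma exists_small_pade {c : ℕ → ℤ} {C : ℕ} (hc : ∀ n, |c n| ≤ (2 * (n + 1)) ^ C) {k : ℕ}
    (hk : 0 < k) :
    ∃ v : ℕ → ℤ, (∃ i ≤ k, v i ≠ 0) ∧
      (∀ m, 1 ≤ m → m ≤ k → ∑ i ∈ Finset.range (k + 1), v i * c (i + m) = 0) ∧
      ∀ i, |(v i : ℝ)| ≤ (((k : ℝ) + 1) * (4 * (k + 1)) ^ C) ^ k := by
  let _ : SeminormedAddCommGroup (Matrix (Fin k) (Fin (k + 1)) ℤ) :=
    Matrix.seminormedAddCommGroup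
  let A : Matrix (Fin k) (Fin (k + 1)) ℤ := Matrix.of fun m i => c (i + (m + 1))
  obtain ⟨t, ht0, htA, htn⟩ := Int.Matrix.exists_ne_zero_int_vec_norm_le A (by simp)
    (by simpa using hk)
  have hA : max 1 ‖A‖ ≤ (4 * ((k : ℝ) + 1)) ^ C := by
    apply max_le
    · apply one_le_pow₀
      have : (0 : ℝ) ≤ k := Nat.cast_nonneg k
      linarith
    · rw [Matrix.norm_le_iff (by positivity)]
      intro m i
      rw [Int.norm_eq_abs]
      have h1 : |(c (i + (m + 1)) : ℝ)| ≤ (2 * (((i + (m + 1) : ℕ) : ℝ) + 1)) ^ C := by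
        exact_mod_cast hc (i + (m + 1))
      refine h1.trans (pow_le_pow_left₀ (by positivity) ?_ C)
      have h2 : 2 * ((i + (m + 1) : ℕ) + 1) ≤ 4 * (k + 1) := by
        have := i.2
        have := m.2
        omega
      exact_mod_cast h2
  have hbound : ‖t‖ ≤ (((k : ℝ) + 1) * (4 * (k + 1)) ^ C) ^ k := by
    refine htn.trans ?_
    have he : (((Fintype.card (Fin k) : ℕ) : ℝ) /
        ((Fintype.card (Fin (k + 1)) : ℕ) - (Fintype.card (Fin k) : ℕ))) = k := by
      simp
    rw [he, Real.rpow_natCast]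
    apply pow_le_pow_left₀ (by positivity)
    rw [Fintype.card_fin]
    push_cast
    gcongr
  refine ⟨fun i => if h : i < k + 1 then t ⟨i, h⟩ else 0, ?_, ?_, ?_⟩
  · obtain ⟨i, hi⟩ := Function.ne_iff.1 ht0
    exact ⟨i, by omega, by
      dsimp only
      rw [dif_pos i.2]
      exact hi⟩
  · intro m hm hmk
    have h1 := congrFun htA ⟨m - 1, by omega⟩
    rw [Finset.sum_range]
    simp only [Matrix.mulVec, dotProduct, Pi.zero_apply] at h1
    rw [← h1]
    refine Finset.sum_congr rfl fun i _ => ?_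
    simp only [A, Matrix.of_apply, Fin.is_lt, dif_pos, Fin.eta]
    rw [Nat.sub_add_cancel hm, mul_comm]
  · intro i
    dsimp only
    split_ifs with h
    · refine le_trans ?_ hbound
      rw [← Int.norm_eq_abs]
      exact norm_le_pi_norm t ⟨i, h⟩
    · simp only [Int.cast_zero, abs_zero]
      positivity

lemma coeff_padeDen (v : ℕ → ℤ) (k j : ℕ) :
    (padeDen v k).coeff j = if j ≤ k then v j else 0 := by
  simp [padeDen, finsetSum_coeff, coeff_X_pow]

lemma natDegree_padeDen_le (v : ℕ → ℤ) (k : ℕ) : (padeDen v k).natDegree ≤ k := by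
  rw [natDegree_le_iff_coeff_eq_zero]
  intro j hj
  rw [coeff_padeDen, if_neg (by omega)]

lemma padeDen_ne_zero {v : ℕ → ℤ} {k : ℕ} (h : ∃ i ≤ k, v i ≠ 0) : padeDen v k ≠ 0 := by
  obtain ⟨i, hi, hv⟩ := h
  intro h0
  have := coeff_padeDen v k i
  rw [h0, if_pos hi] at this
  exact hv (by simpa using this.symm)

lemma coeff_X_pow_mul_sub_shiftPoly {c : ℕ → ℤ} {x : LaurentSeries ℚ}
    (hx : ∀ n : ℕ, x.coeff n = c n) (hx' : ∀ j : ℤ, j < 0 → x.coeff j = 0) (i : ℕ) (j : ℤ) :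
    (ofPoly (X ^ i) * x - ofPoly ((shiftPoly c i).map (Int.castRingHom ℚ))).coeff j =
      if 1 ≤ j then (c (i + j.toNat) : ℚ) else 0 := by
  have hC : ∀ (a : ℤ) (j : ℤ), (ofPoly (Polynomial.C (a : ℚ))).coeff j =
      if j = 0 then (a : ℚ) else 0 := by
    intro a j
    rw [← monomial_zero_left, ofPoly_monomial, HahnSeries.coeff_single]
    simp
  induction i generalizing j with
  | zero =>
    simp only [shiftPoly, pow_zero, map_one, one_mul, map_C_int, HahnSeries.coeff_sub, hC]
    rcases lt_trichotomy j 0 with h | rfl | h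
    · rw [hx' j h, if_neg (by omega), if_neg (by omega), sub_zero]
    · simpa using sub_eq_zero.2 (hx 0)
    · lift j to ℕ using h.le
      rw [if_neg (by omega), if_pos (by omega), hx, sub_zero]
      simp
  | succ i ih =>
    have h1 : ofPoly (X ^ (i + 1)) * x -
        ofPoly ((shiftPoly c (i + 1)).map (Int.castRingHom ℚ)) =
        HahnSeries.single (-1 : ℤ) (1 : ℚ) *
          (ofPoly (X ^ i) * x - ofPoly ((shiftPoly c i).map (Int.castRingHom ℚ))) -
        ofPoly (Polynomial.C ((c (i + 1) : ℤ) : ℚ)) := by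
      have h2 : ofPoly X = HahnSeries.single (-1 : ℤ) (1 : ℚ) := by simp [ofPoly]
      rw [← h2]
      simp only [shiftPoly, Polynomial.map_add, Polynomial.map_mul, map_X, map_C_int,
        map_add, map_mul, pow_succ]
      ring
    rw [h1, HahnSeries.coeff_sub, HahnSeries.coeff_single_mul, ih, hC, one_mul]
    rcases lt_trichotomy j 0 with h | rfl | h
    · rw [if_neg (by omega), if_neg (by omega), if_neg (by omega), sub_zero]
    · simp
    · rw [if_pos (by omega), if_neg (by omega), if_pos (by omega), sub_zero]
      congr 2
      omega

lemma coeff_padeDen_mul_sub_padeNum {c v : ℕ → ℤ} {x : LaurentSeries ℚ}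
    (hx : ∀ n : ℕ, x.coeff n = c n) (hx' : ∀ j : ℤ, j < 0 → x.coeff j = 0) (k : ℕ) (j : ℤ) :
    (ofPoly ((padeDen v k).map (Int.castRingHom ℚ)) * x -
      ofPoly ((padeNum c v k).map (Int.castRingHom ℚ))).coeff j =
      if 1 ≤ j then ((∑ i ∈ Finset.range (k + 1), v i * c (i + j.toNat) : ℤ) : ℚ) else 0 := by
  have h1 : ofPoly ((padeDen v k).map (Int.castRingHom ℚ)) * x -
      ofPoly ((padeNum c v k).map (Int.castRingHom ℚ)) =
      ∑ i ∈ Finset.range (k + 1), HahnSeries.single (0 : ℤ) (v i : ℚ) *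
        (ofPoly (X ^ i) * x - ofPoly ((shiftPoly c i).map (Int.castRingHom ℚ))) := by
    have hC : ∀ a : ℤ, HahnSeries.single (0 : ℤ) (a : ℚ) = ofPoly (Polynomial.C (a : ℚ)) := by
      intro a
      rw [← monomial_zero_left, ofPoly_monomial]
      simp
    simp only [padeDen, padeNum, Polynomial.map_sum, Polynomial.map_mul, map_C_int,
      Polynomial.map_pow, map_X, map_sum, map_mul, Finset.sum_mul, hC,
      ← Finset.sum_sub_distrib]
    refine Finset.sum_congr rfl fun i _ => ?_
    ring
  rw [h1, HahnSeries.coeff_sum]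
  simp only [HahnSeries.coeff_single_zero_mul, coeff_X_pow_mul_sub_shiftPoly hx hx']
  split_ifs
  · push_cast; rfl
  · simp

lemma pow_mul_tsum_sub_shiftPoly {c : ℕ → ℤ} {z : ℝ} (hz : z ≠ 0)
    (hs : Summable fun n : ℕ => (c n : ℝ) * (z⁻¹) ^ n) (i : ℕ) :
    HasSum (fun m : ℕ => (c (i + (m + 1)) : ℝ) * (z⁻¹) ^ (m + 1))
      (z ^ i * (∑' n : ℕ, (c n : ℝ) * (z⁻¹) ^ n) - aeval z (shiftPoly c i)) := by
  induction i with
  | zero =>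
    have h1 := (hasSum_nat_add_iff' 1).2 hs.hasSum
    simpa [shiftPoly] using h1
  | succ i ih =>
    have h1 := (hasSum_nat_add_iff' 1).2 (ih.mul_left z)
    have h2 : z * (z ^ i * (∑' n : ℕ, (c n : ℝ) * (z⁻¹) ^ n) - aeval z (shiftPoly c i)) -
        ∑ m ∈ Finset.range 1, z * ((c (i + (m + 1)) : ℝ) * (z⁻¹) ^ (m + 1)) =
        z ^ (i + 1) * (∑' n : ℕ, (c n : ℝ) * (z⁻¹) ^ n) - aeval z (shiftPoly c (i + 1)) := by
      simp only [shiftPoly, map_add, map_mul, aeval_X, Finset.range_one, Finset.sum_singleton,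
        zero_add, pow_one, aeval_C_int]
      linear_combination (-(c (i + 1) : ℝ)) * mul_inv_cancel₀ hz
    rw [h2] at h1
    refine h1.congr_fun fun m => ?_
    rw [show i + 1 + (m + 1) = i + (m + 1 + 1) by ring, pow_succ z⁻¹ (m + 1)]
    field_simp

lemma abs_padeDen_mul_sub_padeNum_le {c v : ℕ → ℤ} {C k : ℕ} {H : ℝ}
    (hc : ∀ n, |c n| ≤ (2 * (n + 1)) ^ C)
    (hv : ∀ m, 1 ≤ m → m ≤ k → ∑ i ∈ Finset.range (k + 1), v i * c (i + m) = 0)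
    (hH : ∀ i, |(v i : ℝ)| ≤ H) {z : ℤ} (hz : 2 ≤ |z|) :
    |aeval (z : ℝ) (padeDen v k) * (∑' n : ℕ, (c n : ℝ) * ((z : ℝ)⁻¹) ^ n) -
      aeval (z : ℝ) (padeNum c v k)| ≤
      (k + 1) * (4 * (k + 1)) ^ C * H * polyGeomSum C * |(z : ℝ)⁻¹| ^ (k + 1) := by
  have hz0 : (z : ℝ) ≠ 0 := by
    have : z ≠ 0 := by rintro rfl; simp at hz
    exact_mod_cast this
  have hzh := abs_inv_le_half hz
  have hH0 : 0 ≤ H := (abs_nonneg _).trans (hH 0)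
  set y := (z : ℝ)⁻¹ with hy
  have hs := summable_coeff_mul_pow hc hzh
  have h1 : HasSum (fun m : ℕ => ∑ i ∈ Finset.range (k + 1),
      (v i : ℝ) * ((c (i + (m + 1)) : ℝ) * y ^ (m + 1)))
      (aeval (z : ℝ) (padeDen v k) * (∑' n : ℕ, (c n : ℝ) * y ^ n) -
        aeval (z : ℝ) (padeNum c v k)) := by
    have h2 := hasSum_sum (s := Finset.range (k + 1)) fun i _ =>
      (pow_mul_tsum_sub_shiftPoly hz0 hs i).mul_left (v i : ℝ)
    have h3 : aeval (z : ℝ) (padeDen v k) * (∑' n : ℕ, (c n : ℝ) * y ^ n) -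
        aeval (z : ℝ) (padeNum c v k) = ∑ i ∈ Finset.range (k + 1),
        (v i : ℝ) * ((z : ℝ) ^ i * (∑' n : ℕ, (c n : ℝ) * y ^ n) -
          aeval (z : ℝ) (shiftPoly c i)) := by
      simp only [padeDen, padeNum, map_sum, map_mul, aeval_X, map_pow, aeval_C_int,
        Finset.sum_mul, ← Finset.sum_sub_distrib]
      refine Finset.sum_congr rfl fun i _ => ?_
      ring
    rw [h3]
    exact h2
  have hterm : ∀ m : ℕ, ∑ i ∈ Finset.range (k + 1),
      (v i : ℝ) * ((c (i + (m + 1)) : ℝ) * y ^ (m + 1)) =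
      ((∑ i ∈ Finset.range (k + 1), v i * c (i + (m + 1)) : ℤ) : ℝ) * y ^ (m + 1) := by
    intro m
    push_cast
    rw [Finset.sum_mul]
    exact Finset.sum_congr rfl fun i _ => by ring
  have h3 := (hasSum_nat_add_iff' k).2 h1
  rw [Finset.sum_eq_zero, sub_zero] at h3
  swap
  · intro m hm
    rw [hterm, hv (m + 1) (by omega) (by have := Finset.mem_range.1 hm; omega)]
    simp
  have hg := (summable_poly_geometric C).hasSum.mul_left
    ((k + 1) * (4 * (k + 1)) ^ C * H * |y| ^ (k + 1))
  rw [← h3.tsum_eq, ← Real.norm_eq_abs]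
  refine (tsum_of_norm_bounded hg fun m => ?_).trans (le_of_eq ?_)
  · calc _ ≤ ∑ i ∈ Finset.range (k + 1),
          ‖(v i : ℝ) * ((c (i + (m + k + 1)) : ℝ) * y ^ (m + k + 1))‖ := norm_sum_le _ _
      _ ≤ ∑ i ∈ Finset.range (k + 1),
          H * ((4 * (k + 1) * (m + 1)) ^ C * (|y| ^ (k + 1) * (1 / 2) ^ m)) := by
        refine Finset.sum_le_sum fun i hi => ?_
        rw [norm_mul, norm_mul, norm_pow, Real.norm_eq_abs, Real.norm_eq_abs, Real.norm_eq_abs]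
        have h4 : |(c (i + (m + k + 1)) : ℝ)| ≤ (2 * (((i + (m + k + 1) : ℕ) : ℝ) + 1)) ^ C := by
          exact_mod_cast hc (i + (m + k + 1))
        have h5 : 2 * ((i + (m + k + 1)) + 1) ≤ 4 * (k + 1) * (m + 1) := by
          have := Finset.mem_range.1 hi
          nlinarith [Nat.zero_le (k * m)]
        have h6 : (2 * (((i + (m + k + 1) : ℕ) : ℝ) + 1)) ≤ 4 * (k + 1) * (m + 1) := by
          exact_mod_cast h5
        have h7 : |y| ^ (m + k + 1) ≤ |y| ^ (k + 1) * (1 / 2) ^ m := by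
          rw [add_assoc, pow_add, mul_comm]
          gcongr
        gcongr
        · exact hH i
        · exact h4.trans (by gcongr)
      _ = _ := by
        rw [Finset.sum_const, Finset.card_range, nsmul_eq_mul, mul_pow]
        push_cast
        ring
  · rw [polyGeomSum]; ring

lemma abs_aeval_padeDen_le {v : ℕ → ℤ} {k : ℕ} {H : ℝ} (hH : ∀ i, |(v i : ℝ)| ≤ H) {z : ℤ}
    (hz : 2 ≤ |z|) : |aeval (z : ℝ) (padeDen v k)| ≤ (k + 1) * H * |(z : ℝ)| ^ k := by
  have hz' : (1 : ℝ) ≤ |(z : ℝ)| := by exact_mod_cast (by linarith : 1 ≤ |z|)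
  have hH0 : 0 ≤ H := (abs_nonneg _).trans (hH 0)
  simp only [padeDen, map_sum, map_mul, aeval_X, map_pow, aeval_C_int]
  calc _ ≤ ∑ i ∈ Finset.range (k + 1), |(v i : ℝ) * (z : ℝ) ^ i| := Finset.abs_sum_le_sum_abs _ _
    _ ≤ ∑ i ∈ Finset.range (k + 1), H * |(z : ℝ)| ^ k := by
      refine Finset.sum_le_sum fun i hi => ?_
      rw [abs_mul, abs_pow]
      have := Finset.mem_range.1 hi
      have hi' : i ≤ k := by omega
      gcongr
      exact hH i
    _ = _ := by
      rw [Finset.sum_const, Finset.card_range, nsmul_eq_mul, ← mul_assoc]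
      push_cast
      rfl

lemma mahlerSeries_coeff (d : ℕ) (P : ℤ[X]) (n : ℕ) :
    (mahlerSeries d P).coeff (n : ℤ) = mahlerCoeff d P n := by
  rw [mahlerSeries, HahnSeries.ofPowerSeries_apply_coeff, PowerSeries.coeff_map]
  rfl

lemma mahlerSeries_coeff_neg (d : ℕ) (P : ℤ[X]) {j : ℤ} (hj : j < 0) :
    (mahlerSeries d P).coeff j = 0 := by
  rw [mahlerSeries, HahnSeries.ofPowerSeries_apply]
  apply HahnSeries.embDomain_of_notMem_range
  rintro ⟨n, hn⟩
  have : ((n : ℕ) : ℤ) = j := hn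
  omega

lemma exists_height_bound (C M : ℕ) (a : ℝ) :
    ∃ D : ℕ, ∀ m k : ℕ, 2 ≤ m → k ≤ m + M →
      a * (((k : ℝ) + 1) * (4 * (k + 1)) ^ C) ^ (k + 1) ≤ (m : ℝ) ^ (D * m) := by
  refine ⟨⌈a⌉₊ + ((M + 3) + (M + 5) * C) * (M + 2), fun m k hm hk => ?_⟩
  have hm' : (2 : ℝ) ≤ m := by exact_mod_cast hm
  have hpow : ∀ n : ℕ, (n : ℝ) ≤ (m : ℝ) ^ n := by
    intro n
    exact_mod_cast (Nat.lt_pow_self (by omega)).le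
  have hk1 : (k : ℝ) + 1 ≤ (m : ℝ) ^ (M + 3) := by
    have h1 : k + 1 ≤ (M + 2) * m := by
      nlinarith [Nat.mul_le_mul_left M (show 1 ≤ m by omega)]
    have h2 := hpow (M + 2)
    calc (k : ℝ) + 1 ≤ ((M + 2 : ℕ) : ℝ) * m := by exact_mod_cast h1
      _ ≤ (m : ℝ) ^ (M + 2) * m := by gcongr
      _ = _ := by rw [← pow_succ]
  have h4 : (4 : ℝ) * (k + 1) ≤ (m : ℝ) ^ (M + 5) := by
    calc (4 : ℝ) * (k + 1) ≤ (m : ℝ) ^ 2 * (m : ℝ) ^ (M + 3) := by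
          gcongr; nlinarith
      _ = _ := by rw [← pow_add]; ring_nf
  have h5 : ((k : ℝ) + 1) * (4 * (k + 1)) ^ C ≤ (m : ℝ) ^ ((M + 3) + (M + 5) * C) := by
    calc _ ≤ (m : ℝ) ^ (M + 3) * ((m : ℝ) ^ (M + 5)) ^ C := by gcongr
      _ = _ := by rw [← pow_mul, ← pow_add]
  have ha : a ≤ (m : ℝ) ^ (⌈a⌉₊ * m) := by
    calc a ≤ (⌈a⌉₊ : ℝ) := Nat.le_ceil a
      _ ≤ (m : ℝ) ^ ⌈a⌉₊ := hpow _
      _ ≤ _ := pow_le_pow_right₀ (by linarith) (Nat.le_mul_of_pos_right _ (by omega))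
  calc a * (((k : ℝ) + 1) * (4 * (k + 1)) ^ C) ^ (k + 1)
      ≤ (m : ℝ) ^ (⌈a⌉₊ * m) * ((m : ℝ) ^ ((M + 3) + (M + 5) * C)) ^ ((M + 2) * m) := by
        have h6 : k + 1 ≤ (M + 2) * m := by
          nlinarith [Nat.mul_le_mul_left M (show 1 ≤ m by omega)]
        exact mul_le_mul ha ((pow_le_pow_left₀ (by positivity) h5 _).trans
          (pow_le_pow_right₀ (one_le_pow₀ (by linarith)) h6)) (by positivity) (by positivity)
    _ = _ := by rw [← pow_mul, ← pow_add]; ring_nf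

lemma abs_sum_range_le {c : ℕ → ℤ} {C : ℕ} (hc : ∀ n, |c n| ≤ (2 * (n + 1)) ^ C) {x : ℝ}
    (hx : |x| ≤ 1 / 2) (N : ℕ) :
    |∑ n ∈ Finset.range N, (c n : ℝ) * x ^ n| ≤ 2 ^ C * polyGeomSum C := by
  calc _ ≤ ∑ n ∈ Finset.range N, ‖(c n : ℝ) * x ^ n‖ := norm_sum_le _ _
    _ ≤ ∑ n ∈ Finset.range N, 2 ^ C * (((n : ℝ) + 1) ^ C * (1 / 2 : ℝ) ^ n) :=
        Finset.sum_le_sum fun n _ => norm_term_le hc hx n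
    _ = 2 ^ C * ∑ n ∈ Finset.range N, (((n : ℝ) + 1) ^ C * (1 / 2 : ℝ) ^ n) := by
        rw [Finset.mul_sum]
    _ ≤ _ := by
        gcongr
        exact (summable_poly_geometric C).sum_le_tsum _ fun n _ => by positivity

lemma one_le_polyGeomSum (C : ℕ) : 1 ≤ polyGeomSum C := by
  have := (summable_poly_geometric C).sum_le_tsum (Finset.range 1) fun n _ => by positivity
  simpa [polyGeomSum] using this

/-- The numerator of the partial product `∏ P(b ^ (-d ^ i))` over `b ^ (N - 1)`, `N = d ^ t`. -/
noncomputable def partialProductNum (c : ℕ → ℤ) (b : ℤ) (N : ℕ) : ℤ :=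
  ∑ n ∈ Finset.range N, c n * b ^ (N - 1 - n)

lemma cast_partialProductNum (c : ℕ → ℤ) {b : ℤ} (hb : b ≠ 0) (N : ℕ) :
    (partialProductNum c b N : ℝ) =
      (b : ℝ) ^ (N - 1) * ∑ n ∈ Finset.range N, (c n : ℝ) * ((b : ℝ)⁻¹) ^ n := by
  have hb' : (b : ℝ) ≠ 0 := by exact_mod_cast hb
  rw [partialProductNum, Finset.mul_sum]
  push_cast
  refine Finset.sum_congr rfl fun n hn => ?_
  have hn' : n ≤ N - 1 := by have := Finset.mem_range.1 hn; omega
  rw [pow_sub₀ _ hb' hn', inv_pow]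
  ring

lemma linear_form_bounds {d : ℕ} (hd : 2 ≤ d) {P : ℤ[X]} (hP : P.coeff 0 = 1)
    (hdeg : P.natDegree < d) {C : ℕ} (hC : ∀ n, |mahlerCoeff d P n| ≤ (2 * (n + 1)) ^ C)
    {b : ℤ} (hb : 2 ≤ |b|) (t : ℕ) {k : ℕ} {v : ℕ → ℤ} {H : ℝ}
    (hv : ∀ m, 1 ≤ m → m ≤ k → ∑ i ∈ Finset.range (k + 1), v i * mahlerCoeff d P (i + m) = 0)
    (hH : ∀ i, |(v i : ℝ)| ≤ H) :
    |((b ^ (d ^ t - 1) * (padeDen v k).eval (b ^ d ^ t) : ℤ) : ℝ)| ≤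
        (k + 1) * H * |(b : ℝ)| ^ (d ^ t * (k + 1)) ∧
    |((b ^ (d ^ t - 1) * (padeDen v k).eval (b ^ d ^ t) : ℤ) : ℝ) * mahlerValue d P b -
        ((partialProductNum (mahlerCoeff d P) b (d ^ t) *
          (padeNum (mahlerCoeff d P) v k).eval (b ^ d ^ t) : ℤ) : ℝ)| ≤
      (2 ^ C * polyGeomSum C ^ 2 * ((k + 1) * (4 * (k + 1)) ^ C) * H) /
        |(b : ℝ)| ^ (d ^ t * k) := by
  have hb0 : b ≠ 0 := by rintro rfl; simp at hb
  have hbr : (2 : ℝ) ≤ |(b : ℝ)| := by exact_mod_cast hb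
  have hH0 : 0 ≤ H := (abs_nonneg _).trans (hH 0)
  set N := d ^ t with hN
  have hNpos : 0 < N := by positivity
  have hz := two_le_abs_pow hb hNpos.ne'
  have hG := one_le_polyGeomSum C
  have heval : ∀ q : ℤ[X], ((q.eval (b ^ N) : ℤ) : ℝ) = aeval (((b ^ N : ℤ)) : ℝ) q := by
    intro q
    rw [aeval_def, eval₂_at_intCast]
    simp
  have hbN : |(b : ℝ)| ^ (N - 1) ≤ |(b : ℝ)| ^ N :=
    pow_le_pow_right₀ (by linarith) (by omega)
  constructor
  · have h1 := abs_aeval_padeDen_le (k := k) hH hz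
    push_cast [heval]
    rw [abs_mul, abs_pow]
    calc _ ≤ |(b : ℝ)| ^ N * ((k + 1) * H * |((b ^ N : ℤ) : ℝ)| ^ k) := by
          gcongr
          simpa using h1
      _ = _ := by push_cast; rw [abs_pow, ← pow_mul]; ring
  · have h1 := abs_padeDen_mul_sub_padeNum_le hC hv hH hz
    rw [← mahlerValue_eq_tsum hd hP hdeg hz] at h1
    have h2 := abs_sum_range_le hC (abs_inv_le_half hb) N
    rw [mahlerValue_eq_mul hd hP hdeg hb t, Int.cast_mul, Int.cast_mul, heval, heval,
      cast_partialProductNum _ hb0, ← hN]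
    set S := ∑ n ∈ Finset.range N, (mahlerCoeff d P n : ℝ) * ((b : ℝ)⁻¹) ^ n
    have h3 : ((b ^ (N - 1) : ℤ) : ℝ) * aeval (((b ^ N : ℤ)) : ℝ) (padeDen v k) *
        (S * mahlerValue d P (b ^ N)) -
        (b : ℝ) ^ (N - 1) * S * aeval (((b ^ N : ℤ)) : ℝ) (padeNum (mahlerCoeff d P) v k) =
        (b : ℝ) ^ (N - 1) * S * (aeval (((b ^ N : ℤ)) : ℝ) (padeDen v k) *
          mahlerValue d P (b ^ N) -
          aeval (((b ^ N : ℤ)) : ℝ) (padeNum (mahlerCoeff d P) v k)) := by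
      push_cast; ring
    rw [h3, abs_mul, abs_mul, abs_pow]
    calc _ ≤ |(b : ℝ)| ^ N * (2 ^ C * polyGeomSum C) *
          ((k + 1) * (4 * (k + 1)) ^ C * H * polyGeomSum C *
            |(((b ^ N : ℤ)) : ℝ)⁻¹| ^ (k + 1)) := by gcongr
      _ = _ := by
        push_cast
        have : |(b : ℝ)| ^ N ≠ 0 := by positivity
        rw [abs_inv, abs_pow, pow_mul, pow_succ, inv_pow, div_eq_mul_inv]
        field_simp

lemma exists_mahler_approximations {d : ℕ} (hd : 2 ≤ d) {P : ℤ[X]} (hP : P.coeff 0 = 1)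
    (hdeg : P.natDegree < d) (hbad : IsBadlyApproximableSeries (mahlerSeries d P)) :
    ∃ D M : ℕ, ∀ b : ℤ, 2 ≤ |b| → mahlerValue d P b ≠ 0 → ∀ t m : ℕ, 2 ≤ m →
      ∃ A B A' B' : ℤ, A * B' ≠ A' * B ∧
        |(A : ℝ)| ≤ (m : ℝ) ^ (D * m) * |(b : ℝ)| ^ (d ^ t * (m + M)) ∧
        |(A' : ℝ)| ≤ (m : ℝ) ^ (D * m) * |(b : ℝ)| ^ (d ^ t * (m + M)) ∧
        |A * mahlerValue d P b - B| ≤ (m : ℝ) ^ (D * m) / |(b : ℝ)| ^ (d ^ t * m) ∧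
        |A' * mahlerValue d P b - B'| ≤ (m : ℝ) ^ (D * m) / |(b : ℝ)| ^ (d ^ t * m) := by
  obtain ⟨C, hC⟩ := exists_abs_mahlerCoeff_le hd hP hdeg
  obtain ⟨hinf, M, hM⟩ := hbad
  obtain ⟨D, hD⟩ := exists_height_bound C (2 * M) (2 ^ C * polyGeomSum C ^ 2)
  refine ⟨D, 2 * M + 1, fun b hb hne t m hm => ?_⟩
  have hb0 : b ≠ 0 := by rintro rfl; simp at hb
  have hbr : (2 : ℝ) ≤ |(b : ℝ)| := by exact_mod_cast hb
  have hG := one_le_polyGeomSum C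
  obtain ⟨n, hn, hk1, hk2, hk1', hk2'⟩ := exists_convDen_natDegree hinf hM m
  have hbounds : ∀ k, m < k → k ≤ m + 2 * M → ∃ v : ℕ → ℤ, (∃ i ≤ k, v i ≠ 0) ∧
      (∀ m, 1 ≤ m → m ≤ k →
        ∑ i ∈ Finset.range (k + 1), v i * mahlerCoeff d P (i + m) = 0) ∧
      |((b ^ (d ^ t - 1) * (padeDen v k).eval (b ^ d ^ t) : ℤ) : ℝ)| ≤
        (m : ℝ) ^ (D * m) * |(b : ℝ)| ^ (d ^ t * (m + (2 * M + 1))) ∧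
      |((b ^ (d ^ t - 1) * (padeDen v k).eval (b ^ d ^ t) : ℤ) : ℝ) * mahlerValue d P b -
        ((partialProductNum (mahlerCoeff d P) b (d ^ t) *
          (padeNum (mahlerCoeff d P) v k).eval (b ^ d ^ t) : ℤ) : ℝ)| ≤
      (m : ℝ) ^ (D * m) / |(b : ℝ)| ^ (d ^ t * m) := by
    intro k hmk hkM
    obtain ⟨v, hv0, hv, hH⟩ := exists_small_pade hC (k := k) (by omega)
    obtain ⟨h1, h2⟩ := linear_form_bounds hd hP hdeg hC hb t hv hH
    have h3 := hD m k hm hkM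
    set Z := ((k : ℝ) + 1) * (4 * (k + 1)) ^ C with hZ
    have hone : (1 : ℝ) ≤ (4 * (k + 1)) ^ C := by
      apply one_le_pow₀
      have : (0 : ℝ) ≤ k := Nat.cast_nonneg k
      linarith
    have hZk : (k : ℝ) + 1 ≤ Z := le_mul_of_one_le_right (by positivity) hone
    have hZ0 : 0 ≤ Z := by positivity
    have hconst : (1 : ℝ) ≤ 2 ^ C * polyGeomSum C ^ 2 :=
      one_le_mul_of_one_le_of_one_le (one_le_pow₀ (by norm_num)) (one_le_pow₀ hG)
    refine ⟨v, hv0, hv, h1.trans ?_, h2.trans ?_⟩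
    · have h4 : ((k : ℝ) + 1) * Z ^ k ≤ (m : ℝ) ^ (D * m) := by
        calc _ ≤ 1 * (Z * Z ^ k) := by rw [one_mul]; gcongr
          _ ≤ 2 ^ C * polyGeomSum C ^ 2 * (Z * Z ^ k) := by gcongr
          _ = 2 ^ C * polyGeomSum C ^ 2 * Z ^ (k + 1) := by rw [pow_succ' Z k]
          _ ≤ _ := h3
      have h5 : |(b : ℝ)| ^ (d ^ t * (k + 1)) ≤ |(b : ℝ)| ^ (d ^ t * (m + (2 * M + 1))) :=
        pow_le_pow_right₀ (by linarith) (Nat.mul_le_mul_left _ (by omega))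
      gcongr
    · have h4 : 2 ^ C * polyGeomSum C ^ 2 * Z * Z ^ k ≤ (m : ℝ) ^ (D * m) := by
        calc _ = 2 ^ C * polyGeomSum C ^ 2 * Z ^ (k + 1) := by rw [pow_succ' Z k]; ring
          _ ≤ _ := h3
      have h5 : |(b : ℝ)| ^ (d ^ t * m) ≤ |(b : ℝ)| ^ (d ^ t * k) :=
        pow_le_pow_right₀ (by linarith) (Nat.mul_le_mul_left _ (by omega))
      gcongr
  obtain ⟨v, hv0, hv, hA, hL⟩ := hbounds _ hk1 (by omega)
  obtain ⟨v', hv0', hv', hA', hL'⟩ := hbounds _ hk1' hk2'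
  refine ⟨_, _, _, _, ?_, hA, hA', hL, hL'⟩
  set k := (convDen (mahlerSeries d P) n).natDegree
  set k' := (convDen (mahlerSeries d P) (n + 1)).natDegree
  have hW : partialProductNum (mahlerCoeff d P) b (d ^ t) ≠ 0 := by
    intro h0
    have h1 := cast_partialProductNum (mahlerCoeff d P) hb0 (d ^ t)
    rw [h0, Int.cast_zero, eq_comm, mul_eq_zero] at h1
    have h2 : (b : ℝ) ^ (d ^ t - 1) ≠ 0 := pow_ne_zero _ (by exact_mod_cast hb0)
    apply hne
    rw [mahlerValue_eq_mul hd hP hdeg hb t, h1.resolve_left h2, zero_mul]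
  have hvanish : ∀ (v : ℕ → ℤ) (k : ℕ), (∀ m, 1 ≤ m → m ≤ k →
        ∑ i ∈ Finset.range (k + 1), v i * mahlerCoeff d P (i + m) = 0) →
      ∀ j : ℤ, j ≤ k → (ofPoly ((padeDen v k).map (Int.castRingHom ℚ)) * mahlerSeries d P -
        ofPoly ((padeNum (mahlerCoeff d P) v k).map (Int.castRingHom ℚ))).coeff j = 0 := by
    intro v k hv j hj
    rw [coeff_padeDen_mul_sub_padeNum (mahlerSeries_coeff d P)
      (fun j hj => mahlerSeries_coeff_neg d P hj)]
    split_ifs with h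
    · rw [hv j.toNat (by omega) (by omega), Int.cast_zero]
    · rfl
  have hinj : Function.Injective (Int.castRingHom ℚ) := Int.cast_injective
  have hdet := pade_det_eval_ne_zero hinf hn
    ((Polynomial.map_ne_zero_iff hinj).2 (padeDen_ne_zero hv0))
    ((Polynomial.map_ne_zero_iff hinj).2 (padeDen_ne_zero hv0'))
    (natDegree_map_le.trans (natDegree_padeDen_le v k))
    (natDegree_map_le.trans (natDegree_padeDen_le v' k'))
    (hvanish v k hv) (hvanish v' k' hv') ((b ^ d ^ t : ℤ) : ℚ)
  simp only [eval_intCast_map, eq_intCast] at hdet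
  intro heq
  have hne2 : b ^ (d ^ t - 1) * partialProductNum (mahlerCoeff d P) b (d ^ t) ≠ 0 :=
    mul_ne_zero (pow_ne_zero _ hb0) hW
  have hdetZ : (padeDen v k).eval (b ^ d ^ t) *
        (padeNum (mahlerCoeff d P) v' k').eval (b ^ d ^ t) -
      (padeDen v' k').eval (b ^ d ^ t) *
        (padeNum (mahlerCoeff d P) v k).eval (b ^ d ^ t) ≠ 0 := by
    exact_mod_cast hdet
  exact mul_ne_zero hne2 hdetZ (by linear_combination heq)

/-- Values of a badly approximable Mahler product at integers. -/
theorem exists_mahlerValue_lower_bound {d : ℕ} (hd : 2 ≤ d) {P : ℤ[X]} (hP : P.coeff 0 = 1)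
    (hdeg : P.natDegree < d) (hbad : IsBadlyApproximableSeries (mahlerSeries d P)) :
    ∃ K : ℝ, 0 < K ∧ ∀ b : ℤ, 2 ≤ |b| → mahlerValue d P b ≠ 0 →
      HasLinearFormLowerBound K (mahlerValue d P b) := by
  obtain ⟨D, M, h⟩ := exists_mahler_approximations hd hP hdeg hbad
  obtain ⟨K, hK, hK'⟩ := exists_lower_bound_of_approximations hd D M
  refine ⟨K, hK, fun b hb hne => hK' |(b : ℝ)| _ (by exact_mod_cast hb) (h b hb hne)⟩

/-! ### The Thue–Morse series -/

lemma thueMorse_zero : thueMorse 0 = 0 := by rw [thueMorse]; simp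

lemma thueMorse_two_mul (n : ℕ) : thueMorse (2 * n) = thueMorse n := by
  rcases Nat.eq_zero_or_pos n with rfl | hn
  · rfl
  · rw [thueMorse, dif_neg (by omega), if_pos (by omega), Nat.mul_div_cancel_left _ (by norm_num)]

lemma thueMorse_two_mul_add_one (n : ℕ) : thueMorse (2 * n + 1) = 1 - thueMorse n := by
  rw [thueMorse, dif_neg (by omega), if_neg (by omega), show (2 * n + 1) / 2 = n by omega]

lemma thueMorse_le_one (n : ℕ) : thueMorse n ≤ 1 := by
  induction n using Nat.strong_induction_on with
  | _ n ih =>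
    rcases Nat.even_or_odd' n with ⟨m, rfl | rfl⟩
    · rcases Nat.eq_zero_or_pos m with rfl | hm
      · rw [mul_zero, thueMorse_zero]; norm_num
      · rw [thueMorse_two_mul]; exact ih m (by omega)
    · rw [thueMorse_two_mul_add_one]; omega

lemma coeff_zero_one_sub_X : (1 - X : ℤ[X]).coeff 0 = 1 := by simp

lemma natDegree_one_sub_X_lt : (1 - X : ℤ[X]).natDegree < 2 := by
  have : (1 - X : ℤ[X]).natDegree ≤ 1 := by compute_degree
  omega

lemma mahlerCoeff_thueMorse (n : ℕ) :
    mahlerCoeff 2 (1 - X) n = 1 - 2 * (thueMorse n : ℤ) := by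
  have h0 := coeff_zero_one_sub_X
  have h1 := natDegree_one_sub_X_lt
  induction n using Nat.strong_induction_on with
  | _ n ih =>
    rcases Nat.even_or_odd' n with ⟨m, rfl | rfl⟩
    · rcases Nat.eq_zero_or_pos m with rfl | hm
      · rw [mul_zero, thueMorse_zero, mahlerCoeff_zero le_rfl h0]; norm_num
      · have := mahlerCoeff_mul_add le_rfl h0 h1 m (r := 0) (by norm_num)
        rw [add_zero, h0, one_mul, ih m (by omega)] at this
        rw [this, thueMorse_two_mul]
    · have := mahlerCoeff_mul_add le_rfl h0 h1 m (r := 1) (by norm_num)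
      rw [this, ih m (by omega), thueMorse_two_mul_add_one, Nat.cast_sub (thueMorse_le_one m)]
      simp [coeff_one]
      ring

/-- The quadratic equation for the period doubling series has no rational solution. -/
lemma eq_zero_of_quadratic_eq_zero (p q : (ZMod 2)[X])
    (h : X * (X - C 1) * p ^ 2 + (X - C 1) * p * q + q ^ 2 = 0) : q = 0 := by
  induction hn : q.natDegree using Nat.strong_induction_on generalizing p q with
  | _ n ih =>
    set u : (ZMod 2)[X] := X - C 1 with hu
    have hprime : Prime u := prime_X_sub_C 1
    have hu0 : u ≠ 0 := hprime.ne_zero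
    obtain ⟨q₁, rfl⟩ : u ∣ q := by
      refine hprime.dvd_of_dvd_pow (n := 2) ⟨-(X * p ^ 2 + p * q), ?_⟩
      linear_combination h
    have h1 : X * p ^ 2 + u * p * q₁ + u * q₁ ^ 2 = 0 := by
      apply mul_left_cancel₀ hu0
      linear_combination h
    have hX : ¬ u ∣ X := by
      rw [hu, dvd_iff_isRoot]
      simp
    obtain ⟨p₁, rfl⟩ : u ∣ p := by
      refine hprime.dvd_of_dvd_pow (n := 2) ((hprime.dvd_or_dvd ?_).resolve_left hX)
      exact ⟨-(p * q₁ + q₁ ^ 2), by linear_combination h1⟩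
    have h2 : X * u * p₁ ^ 2 + u * p₁ * q₁ + q₁ ^ 2 = 0 := by
      apply mul_left_cancel₀ hu0
      linear_combination h1
    by_contra hq
    have hq₁ : q₁ ≠ 0 := right_ne_zero_of_mul hq
    have hdeg : (u * q₁).natDegree = 1 + q₁.natDegree := by
      rw [natDegree_mul hu0 hq₁, hu, natDegree_X_sub_C]
    exact hq₁ (ih q₁.natDegree (by omega) p₁ q₁ h2 rfl)

/-- The period doubling sequence modulo `2`. -/
def periodDoubling (n : ℕ) : ZMod 2 := (thueMorse (n + 1) : ZMod 2) - thueMorse n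

lemma periodDoubling_two_mul (n : ℕ) : periodDoubling (2 * n) = 1 := by
  rw [periodDoubling, thueMorse_two_mul_add_one, thueMorse_two_mul,
    Nat.cast_sub (thueMorse_le_one n)]
  generalize ((thueMorse n : ℕ) : ZMod 2) = a
  revert a; decide

lemma periodDoubling_two_mul_add_one (n : ℕ) :
    periodDoubling n + periodDoubling (2 * n + 1) = 1 := by
  rw [periodDoubling, periodDoubling, show 2 * n + 1 + 1 = 2 * (n + 1) by ring,
    thueMorse_two_mul_add_one, thueMorse_two_mul, Nat.cast_sub (thueMorse_le_one n)]
  generalize ((thueMorse n : ℕ) : ZMod 2) = a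
  generalize ((thueMorse (n + 1) : ℕ) : ZMod 2) = b
  revert a b; decide

/-- The truncated period doubling series. -/
noncomputable def periodDoublingPoly (N : ℕ) : (ZMod 2)[X] :=
  PowerSeries.trunc N (PowerSeries.mk periodDoubling)

lemma coeff_periodDoublingPoly (N n : ℕ) :
    (periodDoublingPoly N).coeff n = if n < N then periodDoubling n else 0 := by
  rw [periodDoublingPoly, PowerSeries.coeff_trunc, PowerSeries.coeff_mk]

lemma X_pow_dvd_quadratic_periodDoublingPoly (N : ℕ) :
    X ^ N ∣ X * (X - C 1) * periodDoublingPoly N ^ 2 + (X - C 1) * periodDoublingPoly N + 1 := by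
  set G := periodDoublingPoly N with hG
  have hsq : G ^ 2 = expand (ZMod 2) 2 G := (ZMod.expand_card G).symm
  have h1 : X ^ N ∣ X * G ^ 2 + G - ∑ n ∈ Finset.range N, X ^ n := by
    rw [X_pow_dvd_iff]
    intro n hn
    rw [coeff_sub, coeff_add, hsq, finsetSum_coeff]
    simp only [coeff_X_pow, Finset.sum_ite_eq, Finset.mem_range, hn, if_true]
    rcases Nat.even_or_odd' n with ⟨m, rfl | rfl⟩
    · rw [hG, coeff_periodDoublingPoly, if_pos hn, periodDoubling_two_mul]
      rcases m with _ | m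
      · simp
      · rw [show 2 * (m + 1) = (2 * m + 1) + 1 by ring, coeff_X_mul,
          coeff_expand (by norm_num), if_neg (by omega)]
        ring
    · rw [coeff_X_mul, coeff_expand (by norm_num), if_pos (dvd_mul_right _ _),
        Nat.mul_div_cancel_left _ (by norm_num), hG, coeff_periodDoublingPoly,
        coeff_periodDoublingPoly, if_pos hn, if_pos (by omega),
        periodDoubling_two_mul_add_one, sub_self]
  obtain ⟨S, hS⟩ := h1
  have h2 : (∑ n ∈ Finset.range N, X ^ n) * (X - 1 : (ZMod 2)[X]) = X ^ N - 1 := geom_sum_mul X N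
  have h3 : (C 1 : (ZMod 2)[X]) = 1 := C_1
  refine ⟨(X - 1) * S + 1, ?_⟩
  rw [h3]
  linear_combination (X - 1) * hS + h2

/-- A Liouville inequality for the period doubling series over `𝔽₂`. -/
lemma eq_zero_of_hankel_periodDoubling (k : ℕ) (r : ℕ → ZMod 2)
    (h : ∀ m, 1 ≤ m → m ≤ k + 2 →
      ∑ i ∈ Finset.range (k + 1), r i * periodDoubling (i + m) = 0) :
    ∀ i ≤ k, r i = 0 := by
  set N := 2 * k + 3 with hN
  set G := periodDoublingPoly N with hG
  set q : (ZMod 2)[X] := ∑ i ∈ Finset.range (k + 1), monomial (k - i) (r i) with hq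
  set p : (ZMod 2)[X] := PowerSeries.trunc (k + 1) ((q * G : (ZMod 2)[X]) : PowerSeries (ZMod 2))
    with hp
  have hqdeg : q.natDegree ≤ k := by
    refine natDegree_sum_le_of_forall_le _ _ fun i _ => (natDegree_monomial_le _).trans ?_
    omega
  have hpdeg : p.natDegree ≤ k := Nat.lt_succ_iff.1 (PowerSeries.natDegree_trunc_lt _ _)
  have hpG : X ^ N ∣ q * G - p := by
    rw [X_pow_dvd_iff]
    intro n hn
    rw [coeff_sub, hp, PowerSeries.coeff_trunc, Polynomial.coeff_coe]
    split_ifs with hnk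
    · rw [sub_self]
    · obtain ⟨m, rfl⟩ : ∃ m, n = k + m := ⟨n - k, by omega⟩
      rw [sub_zero, hq, Finset.sum_mul, finsetSum_coeff, ← h m (by omega) (by omega)]
      refine Finset.sum_congr rfl fun i hi => ?_
      have hi' := Finset.mem_range.1 hi
      rw [show k + m = (i + m) + (k - i) by omega, coeff_monomial_mul, hG,
        coeff_periodDoublingPoly, if_pos (by omega)]
  have hN0 : X * (X - C 1) * p ^ 2 + (X - C 1) * p * q + q ^ 2 = 0 := by
    by_contra hne
    have hdvd : X ^ N ∣ X * (X - C 1) * p ^ 2 + (X - C 1) * p * q + q ^ 2 := by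
      obtain ⟨S, hS⟩ := hpG
      obtain ⟨T, hT⟩ := X_pow_dvd_quadratic_periodDoublingPoly N
      refine ⟨q ^ 2 * T - S * (X * (X - C 1) * (q * G + p) + (X - C 1) * q), ?_⟩
      linear_combination q ^ 2 * hT - (X * (X - C 1) * (q * G + p) + (X - C 1) * q) * hS
    have h1 := natDegree_le_of_dvd hdvd hne
    rw [natDegree_X_pow] at h1
    have h2 : (X * (X - C 1) * p ^ 2 + (X - C 1) * p * q + q ^ 2).natDegree ≤ 2 * k + 2 := by
      have hp2 : (p ^ 2).natDegree ≤ 2 * k := natDegree_pow_le_of_le 2 hpdeg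
      have hq2 : (q ^ 2).natDegree ≤ 2 * k := natDegree_pow_le_of_le 2 hqdeg
      have hu : (X - C 1 : (ZMod 2)[X]).natDegree ≤ 1 := natDegree_X_sub_C_le _
      have hX : (X : (ZMod 2)[X]).natDegree ≤ 1 := natDegree_X_le
      refine natDegree_add_le_of_degree_le (natDegree_add_le_of_degree_le ?_ ?_) (by omega)
      · exact (natDegree_mul_le_of_le (natDegree_mul_le_of_le hX hu) hp2).trans (by omega)
      · exact (natDegree_mul_le_of_le (natDegree_mul_le_of_le hu hpdeg) hqdeg).trans (by omega)
    omega
  have hq0 := eq_zero_of_quadratic_eq_zero p q hN0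
  intro i hi
  have h1 : q.coeff (k - i) = r i := by
    rw [hq, finsetSum_coeff, Finset.sum_eq_single i]
    · rw [coeff_monomial, if_pos rfl]
    · intro j hj hne
      have := Finset.mem_range.1 hj
      rw [coeff_monomial, if_neg (by omega)]
    · intro hni
      exact absurd (Finset.mem_range.2 (by omega)) hni
  rw [← h1, hq0, coeff_zero]

lemma coeff_ofPoly_mul (q : ℚ[X]) (x : LaurentSeries ℚ) (j : ℤ) :
    (ofPoly q * x).coeff j =
      ∑ i ∈ Finset.range (q.natDegree + 1), q.coeff i * x.coeff (j + i) := by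
  conv_lhs => rw [q.as_sum_range, map_sum, Finset.sum_mul, HahnSeries.coeff_sum]
  refine Finset.sum_congr rfl fun i _ => ?_
  rw [ofPoly_monomial, HahnSeries.coeff_single_mul, sub_neg_eq_add]

lemma exists_primitive_smul_eq {q : ℚ[X]} (hq : q ≠ 0) :
    ∃ (r : ℤ[X]) (a : ℚ), r.IsPrimitive ∧ a ≠ 0 ∧ r.natDegree = q.natDegree ∧
      q = C a * r.map (Int.castRingHom ℚ) := by
  obtain ⟨b, hb, hbq⟩ := IsLocalization.integerNormalization_spec (nonZeroDivisors ℤ) q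
  set s := IsLocalization.integerNormalization (nonZeroDivisors ℤ) q with hs
  have hb0 : (b : ℚ) ≠ 0 := by exact_mod_cast nonZeroDivisors.ne_zero hb
  have hbq' : s.map (Int.castRingHom ℚ) = C (b : ℚ) * q := by
    rw [← smul_eq_C_mul, Int.cast_smul_eq_zsmul]
    exact hbq
  have hinj : Function.Injective (Int.castRingHom ℚ) := Int.cast_injective
  have hs0 : s ≠ 0 := by
    intro h0
    rw [h0, Polynomial.map_zero, eq_comm, mul_eq_zero, C_eq_zero] at hbq'
    exact hbq'.elim hb0 hq
  have hcont : ((s.content : ℤ) : ℚ) ≠ 0 := by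
    exact_mod_cast content_eq_zero_iff.not.2 hs0
  refine ⟨s.primPart, s.content / b, s.isPrimitive_primPart, div_ne_zero hcont hb0, ?_, ?_⟩
  · rw [natDegree_primPart, ← natDegree_map_eq_of_injective hinj, hbq', natDegree_C_mul hb0]
  · have h1 := congrArg (Polynomial.map (Int.castRingHom ℚ)) s.eq_C_content_mul_primPart
    rw [hbq', Polynomial.map_mul, map_C_int] at h1
    rw [div_eq_inv_mul, C_mul, mul_assoc, ← h1, ← mul_assoc, ← C_mul, inv_mul_cancel₀ hb0, C_1,
      one_mul]

lemma isBadlyApproximableSeries_thueMorse : IsBadlyApproximableSeries (mahlerSeries 2 (1 - X)) := by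
  refine isBadlyApproximableSeries_of_liouville 3 fun q p hq => ?_
  by_contra! hvan
  obtain ⟨r, a, hr, ha, hdeg, hqr⟩ := exists_primitive_smul_eq hq
  set k := q.natDegree with hk
  have h1 : ∀ m : ℕ, 1 ≤ m → m ≤ k + 3 →
      ∑ i ∈ Finset.range (k + 1), r.coeff i * (1 - 2 * (thueMorse (i + m) : ℤ)) = 0 := by
    intro m hm hmk
    have h2 := hvan m (by exact_mod_cast hmk)
    rw [HahnSeries.coeff_sub, coeff_ofPoly_pos p (by omega), sub_zero, coeff_ofPoly_mul] at h2
    have h3 : ∀ i : ℕ, q.coeff i * (mahlerSeries 2 (1 - X)).coeff ((m : ℤ) + i) =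
        a * ((r.coeff i * (1 - 2 * (thueMorse (i + m) : ℤ)) : ℤ) : ℚ) := by
      intro i
      rw [show (m : ℤ) + i = ((i + m : ℕ) : ℤ) by push_cast; ring, mahlerSeries_coeff,
        mahlerCoeff_thueMorse, hqr, coeff_C_mul, coeff_map]
      push_cast
      simp
      ring
    simp only [h3, ← Finset.mul_sum] at h2
    exact_mod_cast (mul_eq_zero.1 h2).resolve_left ha
  have h4 : ∀ m : ℕ, 1 ≤ m → m ≤ k + 2 →
      ∑ i ∈ Finset.range (k + 1), (r.coeff i : ZMod 2) * periodDoubling (i + m) = 0 := by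
    intro m hm hmk
    have h5 : 2 * ∑ i ∈ Finset.range (k + 1),
        r.coeff i * ((thueMorse (i + m + 1) : ℤ) - thueMorse (i + m)) = 0 := by
      have h6 := h1 m hm (by omega)
      have h7 := h1 (m + 1) (by omega) (by omega)
      rw [← sub_zero (0 : ℤ)]
      nth_rewrite 1 [← h6]
      rw [← h7, Finset.mul_sum, ← Finset.sum_sub_distrib]
      refine Finset.sum_congr rfl fun i _ => ?_
      rw [← add_assoc]
      ring
    have h8 := congrArg (Int.cast : ℤ → ZMod 2) ((mul_eq_zero.1 h5).resolve_left (by norm_num))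
    push_cast at h8
    exact h8
  have h9 := eq_zero_of_hankel_periodDoubling k (fun i => (r.coeff i : ZMod 2)) h4
  have h10 : C 2 ∣ r := by
    rw [C_dvd_iff_dvd_coeff]
    intro i
    by_cases hi : i ≤ k
    · exact_mod_cast (ZMod.intCast_zmod_eq_zero_iff_dvd (r.coeff i) 2).1 (h9 i hi)
    · rw [coeff_eq_zero_of_natDegree_lt (by omega)]
      exact dvd_zero _
  have := hr 2 h10
  rw [Int.isUnit_iff] at this
  omega

lemma mahlerValue_two_eq :
    mahlerValue 2 (1 - X) 2 = ∑' n : ℕ, (1 - 2 * (thueMorse n : ℝ)) * (1 / 2 : ℝ) ^ n := by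
  rw [mahlerValue_eq_tsum le_rfl coeff_zero_one_sub_X natDegree_one_sub_X_lt (by norm_num)]
  refine tsum_congr fun n => ?_
  rw [mahlerCoeff_thueMorse]
  push_cast
  norm_num

lemma summable_thueMorse : Summable fun n : ℕ => (thueMorse n : ℝ) * (1 / 2 : ℝ) ^ n := by
  refine Summable.of_nonneg_of_le (fun n => by positivity) (fun n => ?_)
    (summable_geometric_of_lt_one (by norm_num) (by norm_num : (1 / 2 : ℝ) < 1))
  have : (thueMorse n : ℝ) ≤ 1 := by exact_mod_cast thueMorse_le_one n
  exact mul_le_of_le_one_left (by positivity) this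

lemma thueMorseConstant_eq :
    thueMorseConstant = (((2 : ℤ) : ℝ) + ((-1 : ℤ) : ℝ) * mahlerValue 2 (1 - X) 2) /
      ((4 : ℤ) : ℝ) := by
  have h1 : thueMorseConstant = 1 / 2 * ∑' n : ℕ, (thueMorse n : ℝ) * (1 / 2 : ℝ) ^ n := by
    rw [thueMorseConstant, ← tsum_mul_left]
    refine tsum_congr fun n => ?_
    rw [pow_succ, one_div_pow]
    field_simp
  have h2 : mahlerValue 2 (1 - X) 2 =
      2 - 2 * ∑' n : ℕ, (thueMorse n : ℝ) * (1 / 2 : ℝ) ^ n := by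
    have h3 := (hasSum_geometric_two.sub (summable_thueMorse.hasSum.mul_left 2)).tsum_eq
    rw [mahlerValue_two_eq, ← h3]
    refine tsum_congr fun n => ?_
    ring
  rw [h1, h2]
  push_cast
  ring

lemma mahlerValue_two_ne_zero : mahlerValue 2 (1 - X) 2 ≠ 0 := by
  have hs : Summable fun n : ℕ => (1 - 2 * (thueMorse n : ℝ)) * (1 / 2 : ℝ) ^ n := by
    refine (summable_geometric_two.sub (summable_thueMorse.mul_left 2)).congr fun n => ?_
    ring
  rw [mahlerValue_two_eq, ← hs.sum_add_tsum_nat_add 4]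
  have htail : ‖∑' n : ℕ, (1 - 2 * (thueMorse (n + 4) : ℝ)) * (1 / 2 : ℝ) ^ (n + 4)‖ ≤
      1 / 16 * 2 := by
    refine tsum_of_norm_bounded (hasSum_geometric_two.mul_left (1 / 16)) fun n => ?_
    rw [norm_mul, norm_pow, pow_add]
    have h1 : ‖1 - 2 * (thueMorse (n + 4) : ℝ)‖ ≤ 1 := by
      have : (thueMorse (n + 4) : ℝ) ≤ 1 := by exact_mod_cast thueMorse_le_one _
      have : (0 : ℝ) ≤ thueMorse (n + 4) := Nat.cast_nonneg _
      rw [Real.norm_eq_abs, abs_le]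
      constructor <;> linarith
    calc _ ≤ 1 * (‖(1 / 2 : ℝ)‖ ^ n * ‖(1 / 2 : ℝ)‖ ^ 4) := by gcongr
      _ = _ := by norm_num; ring
  have ht : thueMorse 0 = 0 ∧ thueMorse 1 = 1 ∧ thueMorse 2 = 1 ∧ thueMorse 3 = 0 := by
    have h0 := thueMorse_zero
    have h1 := thueMorse_two_mul_add_one 0
    have h2 := thueMorse_two_mul 1
    have h3 := thueMorse_two_mul_add_one 1
    norm_num at h1 h2 h3
    omega
  obtain ⟨h0, h1, h2, h3⟩ := ht
  have hhead : ∑ n ∈ Finset.range 4, (1 - 2 * (thueMorse n : ℝ)) * (1 / 2 : ℝ) ^ n = 3 / 8 := by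
    simp only [Finset.sum_range_succ, Finset.sum_range_zero, h0, h1, h2, h3]
    norm_num
  rw [hhead]
  rw [Real.norm_eq_abs, abs_le] at htail
  linarith [htail.1]

end MahlerMeasure

theorem theorem1 :
    (∀ (d : ℕ) (P : Polynomial ℤ), 2 ≤ d → P.coeff 0 = 1 → P.natDegree < d →
      MahlerMeasure.IsBadlyApproximableSeries (MahlerMeasure.mahlerSeries d P) →
      ∃ K : ℝ, 0 < K ∧ ∀ b : ℤ, 2 ≤ |b| →
        MahlerMeasure.mahlerValue d P b = 0 ∨
          MahlerMeasure.IsPsiBadlyApproximable (MahlerMeasure.psi K)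
            (MahlerMeasure.mahlerValue d P b)) ∧
    (∃ K : ℝ, 0 < K ∧
      MahlerMeasure.IsPsiBadlyApproximable (MahlerMeasure.psi K)
        MahlerMeasure.thueMorseConstant) := by
  constructor
  · intro d P hd hP hdeg hbad
    obtain ⟨K, hK, h⟩ := MahlerMeasure.exists_mahlerValue_lower_bound hd hP hdeg hbad
    exact ⟨K, hK, fun b hb =>
      or_iff_not_imp_left.2 fun hne => (h b hb hne).isPsiBadlyApproximable⟩
  · obtain ⟨K, hK, h⟩ := MahlerMeasure.exists_mahlerValue_lower_bound le_rfl
      MahlerMeasure.coeff_zero_one_sub_X MahlerMeasure.natDegree_one_sub_X_lt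
      MahlerMeasure.isBadlyApproximableSeries_thueMorse
    exact ⟨K + 1, by linarith, ((h 2 (by norm_num) MahlerMeasure.mahlerValue_two_ne_zero).affine
      2 (-1) 4 (by norm_num) MahlerMeasure.thueMorseConstant_eq
      (by norm_num)).isPsiBadlyApproximable⟩
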